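/- Let $m\ge 1$, let $p_i,q_i\in\mathbb{R}[x]$ ($i=1,\dots,m$) and $g_j\in\mathbb{R}[x]$ ($j=1,\dots,r$) be real polynomials in $x=(x_1,\dots,x_n)$, and let $\Omega=\{x\in\mathbb{R}^n: g_j(x)\ge 0,\ j=1,\dots,r\}$. Assume that $\Omega$ is nonempty and compact, that $\Omega\subseteq\Delta:=[-1,1]^n$, and that $q_i>0$ on $\Omega$ for all $i$. Let $\Sigma^2[\cdot]$ denote the sums of squares of polynomials. Let $f_i^{\rm lower},f_i^{\rm upper}\in\mathbb{R}$ be such that, for each $i$, both $p_i-f_i^{\rm lower}q_i$ and $f_i^{\rm upper}q_i-p_i$ can be written as $\sigma_0+\sum_{j=1}^r\sigma_jg_j+\sum_{j=1}^n\tau_j(1-x_j^2)$ with $\sigma_0,\sigma_j,\tau_j\in\Sigma^2[x]$ (with all summands of degree at most $2k_i$ for some $k_i\in\mathbb{N}$), and put $f^{\rm lower}=\min_i f_i^{\rm lower}$, $f^{\rm upper}=\max_i f_i^{\rm upper}$. For $x\in\Delta$ let $\mathbf{K}_x$ be the set of all $(y,z)\in\mathbb{R}^n\times\mathbb{R}$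 with $y\in\Omega$, $z\in[f^{\rm lower}-f^{\rm upper},\,f^{\rm upper}-f^{\rm lower}]$ and $$p_i(x)q_i(y)-p_i(y)q_i(x)-z\,q_i(x)q_i(y)\ge 0,\qquad i=1,\dots,m.$$ Assume that $\mathbf{K}_x\neq\emptyset$ for every $x\in\Delta$, and let $\tilde\psi(x)=\max\{z:(y,z)\in\mathbf{K}_x\}$ for $x\in\Delta$. Let $h_{i,j}\in\mathbb{R}[x,y,z]$ be the $m+r+2n+1$ polynomials $p_i(x)q_i(y)-p_i(y)q_i(x)-zq_i(x)q_i(y)$ ($1\le i\le m$), $g_j(y)$ ($1\le j\le r$), $1-y_j^2$ and $1-x_j^2$ ($1\le j\le n$), and $(f^{\rm upper}-f^{\rm lower})^2-z^2$. Let $\lambda$ be the scaled Lebesgue measure $d\lambda(x)=dx/2^n$ on $\Delta$. For $k\in\mathbb{N}$ with $k\ge\lceil\deg h_{i,j}/2\rceil$ for all $i,j$, consider the problem $$(\mathrm{P}_k)\qquad \rho_k^*=\inf\int_\Delta\phi\,d\lambda$$ over all $\phi\in\mathbb{R}[x]$ with $\deg\phi\le 2k$ and all $\sigma_0,\sigma_{i,j}\in\Sigma^2[x,y,z]$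 with $\phi(x)-z=\sigma_0+\sum_{i,j}\sigma_{i,j}h_{i,j}$ and $\deg\sigma_0\le 2k$, $\deg(\sigma_{i,j}h_{i,j})\le 2k$ for all $i,j$. Then $\tilde\psi$ is $\lambda$-integrable and $$\lim_{k\to\infty}\rho_k^*=\int_\Delta\tilde\psi\,d\lambda .$$ Consequently, let $(\psi_k,\sigma_0^{(k)},\sigma_{i,j}^{(k)})$ be nearly optimal solutions of $(\mathrm{P}_k)$, that is, feasible points with $\int_\Delta\psi_k\,d\lambda\le\rho_k^*+\varepsilon_k$ where $\varepsilon_k\to 0$ (for example $\varepsilon_k=1/k$). Then $\psi_k\ge\tilde\psi$ on $\Delta$ for all such $k$, and $$\lim_{k\to\infty}\int_\Delta|\psi_k-\tilde\psi|\,d\lambda=0 .$$ Moreover, each $(\mathrm{P}_k)$ is a semidefinite program: there are real symmetric matrices $C,A_1,\dots,A_L$ of some size $N$, reals $b_1,\dots,b_L$, and a linear map $\Phi$ from the real $N\times N$ matrices to $\mathbb{R}[x]$ such that, for $\mathcal{S}=\{Y\succeq 0:\operatorname{tr}(A_lY)=b_l,\ l=1,\dots,L\}$, the polynomials $\phi$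 that are feasible for $(\mathrm{P}_k)$ (with suitable $\sigma_0,\sigma_{i,j}$) are exactly the $\Phi(Y)$ with $Y\in\mathcal{S}$, and $\operatorname{tr}(CY)=\int_\Delta\Phi(Y)\,d\lambda$ for all $Y\in\mathcal{S}$. -/

import Mathlib

open MvPolynomial MeasureTheory Filter Topology

noncomputable section

/-- The data of the vector rational optimization problem: minimize
`(p₁/q₁, …, p_m/q_m)` over `Ω = {x ∈ ℝⁿ : g₁(x) ≥ 0, …, g_r(x) ≥ 0}`. -/
structure RationalVectorProblem (n m r : ℕ) where
  p : Fin m → MvPolynomial (Fin n) ℝ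
  q : Fin m → MvPolynomial (Fin n) ℝ
  g : Fin r → MvPolynomial (Fin n) ℝ

/-- The cube `Δ = [-1, 1]ⁿ`. -/
def cube (n : ℕ) : Set (Fin n → ℝ) := {x | ∀ i, x i ∈ Set.Icc (-1 : ℝ) 1}

/-- The scaled Lebesgue measure `dλ = dx / 2ⁿ` on `Δ`. -/
def cubeMeasure (n : ℕ) : Measure (Fin n → ℝ) :=
  ((2 : ENNReal) ^ n)⁻¹ • (volume.restrict (cube n))

/-- The variables `(x, y, z) ∈ ℝⁿ × ℝⁿ × ℝ`. -/
abbrev XYZ (n : ℕ) : Type := Fin n ⊕ Fin n ⊕ Unit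

/-- A polynomial `f(x)` of `ℝ[x]` as an element of `ℝ[x, y, z]`. -/
def inX {n : ℕ} (f : MvPolynomial (Fin n) ℝ) : MvPolynomial (XYZ n) ℝ :=
  rename Sum.inl f

/-- The polynomial `f(y)` of `ℝ[x, y, z]`, for `f ∈ ℝ[x]`. -/
def inY {n : ℕ} (f : MvPolynomial (Fin n) ℝ) : MvPolynomial (XYZ n) ℝ :=
  rename (fun i => Sum.inr (Sum.inl i)) f

/-- The variable `z` of `ℝ[x, y, z]`. -/
def varZ (n : ℕ) : MvPolynomial (XYZ n) ℝ := X (Sum.inr (Sum.inr ()))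

namespace RationalVectorProblem

variable {n m r : ℕ} (P : RationalVectorProblem n m r)

/-- The feasible set `Ω`. -/
def feasibleSet : Set (Fin n → ℝ) := {x | ∀ j, 0 ≤ eval x (P.g j)}

/-- `h = σ₀ + ∑ⱼ σⱼ gⱼ + ∑ⱼ τⱼ (1 - xⱼ²)` with sums of squares `σ₀, σⱼ, τⱼ` such that the
degree of every summand is at most `2k`, for some `k`. -/
def IsCertified (h : MvPolynomial (Fin n) ℝ) : Prop :=
  ∃ (k : ℕ) (σ₀ : MvPolynomial (Fin n) ℝ) (σ : Fin r → MvPolynomial (Fin n) ℝ)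
    (τ : Fin n → MvPolynomial (Fin n) ℝ),
    IsSumSq σ₀ ∧ (∀ j, IsSumSq (σ j)) ∧ (∀ j, IsSumSq (τ j)) ∧
    σ₀.totalDegree ≤ 2 * k ∧
    (∀ j, (σ j * P.g j).totalDegree ≤ 2 * k) ∧
    (∀ j, (τ j * (1 - X j ^ 2)).totalDegree ≤ 2 * k) ∧
    h = σ₀ + ∑ j, σ j * P.g j + ∑ j, τ j * (1 - X j ^ 2)

/-- The set `𝐊ₓ` of all `(y, z)` that are feasible for the parametric problem defining `ψ̃(x)`. -/
def fiber (fLower fUpper : ℝ) (x : Fin n → ℝ) : Set ((Fin n → ℝ) × ℝ) :=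
  {w | w.1 ∈ P.feasibleSet ∧ w.2 ∈ Set.Icc (fLower - fUpper) (fUpper - fLower) ∧
    ∀ i, 0 ≤ eval x (P.p i) * eval w.1 (P.q i) - eval w.1 (P.p i) * eval x (P.q i)
      - w.2 * eval x (P.q i) * eval w.1 (P.q i)}

/-- The function `ψ̃(x) = max {z : (y, z) ∈ 𝐊ₓ}`. -/
def psiTilde (fLower fUpper : ℝ) (x : Fin n → ℝ) : ℝ :=
  sSup (Prod.snd '' P.fiber fLower fUpper x)

end RationalVectorProblem

/-- The index set of the `m + (r + n) + n + 1` polynomials `h_{i,j}`. -/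
abbrev ConstraintIndex (n m r : ℕ) : Type := Fin m ⊕ (Fin r ⊕ Fin n) ⊕ Fin n ⊕ Unit

namespace RationalVectorProblem

variable {n m r : ℕ} (P : RationalVectorProblem n m r)

/-- The polynomials `h_{i,j} ∈ ℝ[x, y, z]` describing the set `𝐊`. -/
def constraint (fLower fUpper : ℝ) : ConstraintIndex n m r → MvPolynomial (XYZ n) ℝ
  | Sum.inl i => inX (P.p i) * inY (P.q i) - inY (P.p i) * inX (P.q i)
      - varZ n * inX (P.q i) * inY (P.q i)
  | Sum.inr (Sum.inl (Sum.inl j)) => inY (P.g j)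
  | Sum.inr (Sum.inl (Sum.inr j)) => 1 - inY (X j) ^ 2
  | Sum.inr (Sum.inr (Sum.inl j)) => 1 - inX (X j) ^ 2
  | Sum.inr (Sum.inr (Sum.inr ())) => C ((fUpper - fLower) ^ 2) - varZ n ^ 2

/-- `k ≥ ⌈deg h_{i,j} / 2⌉` for all `i, j`. -/
def IsOrder (fLower fUpper : ℝ) (k : ℕ) : Prop :=
  ∀ j, (P.constraint fLower fUpper j).totalDegree ≤ 2 * k

/-- `(φ, σ₀, (σ_{i,j}))` is feasible for the problem `(P_k)`. -/
def IsFeasible (fLower fUpper : ℝ) (k : ℕ) (φ : MvPolynomial (Fin n) ℝ)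
    (σ₀ : MvPolynomial (XYZ n) ℝ) (σ : ConstraintIndex n m r → MvPolynomial (XYZ n) ℝ) : Prop :=
  φ.totalDegree ≤ 2 * k ∧
  IsSumSq σ₀ ∧ (∀ j, IsSumSq (σ j)) ∧
  inX φ - varZ n = σ₀ + ∑ j, σ j * P.constraint fLower fUpper j ∧
  σ₀.totalDegree ≤ 2 * k ∧
  ∀ j, (σ j * P.constraint fLower fUpper j).totalDegree ≤ 2 * k

/-- The optimal value `ρ*_k` of `(P_k)`, an extended real number (`+∞` if there is no feasible
point). -/
def optimalValue (fLower fUpper : ℝ) (k : ℕ) : EReal :=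
  sInf {v : EReal | ∃ φ σ₀ σ, P.IsFeasible fLower fUpper k φ σ₀ σ ∧
    v = ((∫ x, eval x φ ∂(cubeMeasure n) : ℝ) : EReal)}

end RationalVectorProblem

/-- A semidefinite program in standard form: minimize `tr (C X)` over the positive semidefinite
matrices `X` with `tr (A_l X) = b_l` for all `l`. -/
structure SemidefiniteProgram (N L : ℕ) where
  C : Matrix (Fin N) (Fin N) ℝ
  A : Fin L → Matrix (Fin N) (Fin N) ℝ
  b : Fin L → ℝ
  C_symm : C.IsSymm
  A_symm : ∀ l, (A l).IsSymm

/-- The feasible matrices of a semidefinite program. -/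
def SemidefiniteProgram.feasible {N L : ℕ} (S : SemidefiniteProgram N L) :
    Set (Matrix (Fin N) (Fin N) ℝ) :=
  {X | X.PosSemidef ∧ ∀ l, (S.A l * X).trace = S.b l}

end

/-! Evaluating a certificate for `φ(x) - z` on the set `𝐊` of all `(x, y, z)` with `x ∈ Δ`, `(y, z)
∈ 𝐊ₓ` gives `φ ≥ ψ̃` on `Δ`, so every feasible value is at least `∫ ψ̃`. Conversely, `ψ̃` is the
upper envelope of a compact set, hence a pointwise limit of bounded continuous majorants. Dominated
convergence and Stone–Weierstrass turn one of these into a polynomial `φ` with `φ(x) > z` on `𝐊` and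
integral below `∫ ψ̃ + ε`; `putinar` makes it feasible at some order, hence at all later ones. As
`ψ_k ≥ ψ̃`, the L¹ distance is a difference of integrals, so it tends to zero.

Putinar's theorem is derived from `QuadraticModule.mem_of_forall_pos`. If `f ∉ M`, some state is
nonpositive at `f`; the states form a compact convex set, so an extreme state minimizing `f` exists.
Extreme states are multiplicative, so this one is a character with value at most zero at `f`.

For the semidefinite form, sums of squares of degree at most `2k` are replaced by positive
semidefinite Gram matrices, collected as diagonal blocks of one matrix; the polynomial identity and
the degree bounds are linear in it. -/

/-! ### Archimedean quadratic modules and their states. -/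

/-- A quadratic module of a commutative ring: it contains `1` and is closed under addition and
under multiplication by squares. -/
structure QuadraticModule (A : Type*) [CommRing A] extends AddSubmonoid A where
  one_mem' : (1 : A) ∈ carrier
  sq_mul_mem' : ∀ (a : A) {m : A}, m ∈ carrier → a ^ 2 * m ∈ carrier

namespace QuadraticModule

variable {A : Type*} [CommRing A]

instance : SetLike (QuadraticModule A) A where
  coe M := M.carrier
  coe_injective M N h := by
    obtain ⟨⟨⟨_, _⟩, _⟩, _, _⟩ := M
    obtain ⟨⟨⟨_, _⟩, _⟩, _, _⟩ := N
    congr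

variable {M : QuadraticModule A} {a b : A}

theorem zero_mem : (0 : A) ∈ M := M.zero_mem'

theorem one_mem : (1 : A) ∈ M := M.one_mem'

theorem add_mem (ha : a ∈ M) (hb : b ∈ M) : a + b ∈ M := M.add_mem' ha hb

theorem sq_mul_mem (a : A) (hb : b ∈ M) : a ^ 2 * b ∈ M := M.sq_mul_mem' a hb

theorem sq_mem (a : A) : a ^ 2 ∈ M := by simpa using sq_mul_mem a (one_mem (M := M))

variable [Algebra ℝ A]

theorem smul_mem {c : ℝ} (hc : 0 ≤ c) (ha : a ∈ M) : c • a ∈ M := by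
  have := sq_mul_mem (algebraMap ℝ A (Real.sqrt c)) ha
  rwa [← map_pow, Real.sq_sqrt hc, ← Algebra.smul_def] at this

theorem algebraMap_mem {c : ℝ} (hc : 0 ≤ c) : algebraMap ℝ A c ∈ M := by
  simpa [Algebra.smul_def] using smul_mem hc (one_mem (M := M))

theorem algebraMap_sub_mem_of_le {c d : ℝ} (h : algebraMap ℝ A c - a ∈ M) (hcd : c ≤ d) :
    algebraMap ℝ A d - a ∈ M := by
  have := add_mem h (algebraMap_mem (M := M) (sub_nonneg.2 hcd))
  rw [map_sub] at this
  convert this using 1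
  ring

variable (M) in
/-- A quadratic module is Archimedean if every element of the algebra is bounded above by a real
constant modulo the quadratic module. -/
def IsArchimedean : Prop := ∀ a : A, ∃ N : ℝ, algebraMap ℝ A N - a ∈ M

variable (M) in
/-- The elements whose square is bounded form a subalgebra. -/
def boundedElements : Subalgebra ℝ A where
  carrier := {a | ∃ N : ℝ, 0 ≤ N ∧ algebraMap ℝ A N - a ^ 2 ∈ M}
  mul_mem' := by
    rintro a b ⟨N, hN, ha⟩ ⟨K, hK, hb⟩
    refine ⟨K * N, by positivity, ?_⟩
    -- `KN - a²b² = K(N - a²) + a²(K - b²)`.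
    have := add_mem (smul_mem hK ha) (sq_mul_mem a hb)
    rw [Algebra.smul_def] at this
    convert this using 1
    rw [map_mul]
    ring
  add_mem' := by
    rintro a b ⟨N, hN, ha⟩ ⟨K, hK, hb⟩
    refine ⟨2 * N + 2 * K, by positivity, ?_⟩
    -- Parallelogram law: `2a² + 2b² - (a + b)² = (a - b)²`.
    have := add_mem (add_mem (smul_mem zero_le_two ha) (smul_mem zero_le_two hb)) (sq_mem (a - b))
    simp only [Algebra.smul_def, map_ofNat] at this
    convert this using 1
    simp only [map_add, map_mul, map_ofNat]
    ring
  algebraMap_mem' c := ⟨c ^ 2, sq_nonneg c, by simpa using zero_mem⟩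

/-- From `(1 - a)² ≥ 0` one gets `2a ≤ 1 + a² ≤ 1 + N`. Boundedness of squares therefore only has to
be checked on algebra generators. -/
theorem isArchimedean_of_boundedElements_eq_top (h : M.boundedElements = ⊤) :
    M.IsArchimedean := by
  intro a
  obtain ⟨N, -, hN⟩ : a ∈ M.boundedElements := h ▸ Algebra.mem_top
  refine ⟨(N + 1) / 2, ?_⟩
  have := smul_mem (c := 1 / 2) (by norm_num) (add_mem hN (sq_mem (1 - a)))
  rw [Algebra.smul_def] at this
  convert this using 1
  have h2 : algebraMap ℝ A (1 / 2) * 2 = 1 := by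
    rw [← map_ofNat (algebraMap ℝ A) 2, ← map_mul]
    norm_num
  have : algebraMap ℝ A ((N + 1) / 2) = algebraMap ℝ A (1 / 2) * (algebraMap ℝ A N + 1) := by
    rw [← map_one (algebraMap ℝ A), ← map_add, ← map_mul]
    congr 1
    ring
  rw [this]
  linear_combination a * h2

variable (M) in
/-- The states of a quadratic module: normalized linear functionals that are nonnegative on it. -/
def states : Set (A → ℝ) :=
  {L | (∀ a b, L (a + b) = L a + L b) ∧ (∀ (c : ℝ) a, L (c • a) = c * L a) ∧ L 1 = 1 ∧
    ∀ a ∈ M, 0 ≤ L a}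

/-- A state is a linear functional. -/
def states.toLinearMap {L : A → ℝ} (hL : L ∈ M.states) : A →ₗ[ℝ] ℝ where
  toFun := L
  map_add' := hL.1
  map_smul' := hL.2.1

theorem states.map_sub {L : A → ℝ} (hL : L ∈ M.states) (a b : A) : L (a - b) = L a - L b :=
  _root_.map_sub (states.toLinearMap hL) a b

theorem states.map_neg {L : A → ℝ} (hL : L ∈ M.states) (a : A) : L (-a) = -L a :=
  _root_.map_neg (states.toLinearMap hL) a

theorem states.map_algebraMap_mul {L : A → ℝ} (hL : L ∈ M.states) (c : ℝ) (a : A) :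
    L (algebraMap ℝ A c * a) = c * L a := by
  rw [← Algebra.smul_def, hL.2.1]

theorem states.map_algebraMap {L : A → ℝ} (hL : L ∈ M.states) (c : ℝ) :
    L (algebraMap ℝ A c) = c := by
  simpa [hL.2.2.1] using states.map_algebraMap_mul hL c 1

theorem isClosed_states : IsClosed M.states := by
  have : M.states = (⋂ a, ⋂ b, {L : A → ℝ | L (a + b) = L a + L b}) ∩
      ((⋂ c : ℝ, ⋂ a, {L : A → ℝ | L (c • a) = c * L a}) ∩
        ({L : A → ℝ | L 1 = 1} ∩ ⋂ a ∈ M, {L : A → ℝ | 0 ≤ L a})) := by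
    ext L
    simp [states]
  rw [this]
  refine .inter ?_ (.inter ?_ (.inter ?_ ?_))
  · exact isClosed_iInter fun a => isClosed_iInter fun b =>
      isClosed_eq (by fun_prop) (by fun_prop)
  · exact isClosed_iInter fun a => isClosed_iInter fun b =>
      isClosed_eq (by fun_prop) (by fun_prop)
  · exact isClosed_eq (by fun_prop) (by fun_prop)
  · exact isClosed_biInter fun a _ => isClosed_le (by fun_prop) (by fun_prop)

/-- Tychonoff in the topology of pointwise convergence: the Archimedean bounds for `a` and `-a`
confine `L a` to a compact interval. -/
theorem isCompact_states (hM : M.IsArchimedean) : IsCompact M.states := by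
  choose N hN using hM
  refine (isCompact_univ_pi fun a : A => isCompact_Icc (a := -N (-a)) (b := N a)).of_isClosed_subset
    isClosed_states fun L hL a _ => ?_
  have h1 := hL.2.2.2 _ (hN a)
  have h2 := hL.2.2.2 _ (hN (-a))
  rw [states.map_sub hL, states.map_algebraMap hL] at h1 h2
  rw [states.map_neg hL] at h2
  exact ⟨by linarith, by linarith⟩

/-- The cone of all `m - t • f` with `m` in the quadratic module and `t ≥ 0`. -/
def coneSub (M : QuadraticModule A) (f : A) : PointedCone ℝ A where
  carrier := {a | ∃ m ∈ M, ∃ t : ℝ, 0 ≤ t ∧ a = m - t • f}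
  smul_mem' := by
    rintro ⟨c, hc⟩ _ ⟨m, hm, t, ht, rfl⟩
    exact ⟨c • m, smul_mem hc hm, c * t, mul_nonneg hc ht, by
      rw [Nonneg.mk_smul, smul_sub, mul_smul]⟩
  zero_mem' := ⟨0, zero_mem, 0, le_rfl, by simp⟩
  add_mem' := by
    rintro _ _ ⟨m, hm, t, ht, rfl⟩ ⟨m', hm', t', ht', rfl⟩
    exact ⟨m + m', add_mem hm hm', t + t', by positivity, by rw [add_smul]; abel⟩

/-- M. Riesz extension of `c • 1 ↦ c` from the line `ℝ • 1`, positive with respect to `M.coneSub f`.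
This cone contains both `M` and `-f`. -/
theorem exists_state_nonpos [Nontrivial A] (hM : M.IsArchimedean) {f : A} (hf : f ∉ M) :
    ∃ L ∈ M.states, L f ≤ 0 := by
  let l : A →ₗ.[ℝ] ℝ := LinearPMap.mkSpanSingleton 1 (1 : ℝ) one_ne_zero
  have hl1 : l ⟨1, Submodule.mem_span_singleton_self 1⟩ = 1 :=
    LinearPMap.mkSpanSingleton_apply ℝ ℝ one_ne_zero 1
  have hl : ∀ (c : ℝ) (hx : c • (1 : A) ∈ l.domain), l ⟨c • 1, hx⟩ = c := fun c hx => by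
    have := l.map_smul c ⟨1, Submodule.mem_span_singleton_self 1⟩
    rw [hl1, smul_eq_mul, mul_one] at this
    exact this
  suffices h : ∃ g : A →ₗ[ℝ] ℝ, (∀ x : l.domain, g x = l x) ∧ ∀ x ∈ M.coneSub f, 0 ≤ g x by
    obtain ⟨g, hg, hgs⟩ := h
    refine ⟨g, ⟨map_add g, fun c a => by simp, (hg ⟨1, _⟩).trans hl1, fun a ha => ?_⟩, ?_⟩
    · exact hgs a ⟨a, ha, 0, le_rfl, by simp⟩
    · have := hgs (-f) ⟨0, zero_mem, 1, zero_le_one, by simp⟩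
      simpa using this
  refine riesz_extension (M.coneSub f) l ?_ ?_
  · rintro ⟨x, hx⟩ ⟨m, hm, t, ht, hxm⟩
    obtain ⟨c, rfl⟩ := Submodule.mem_span_singleton.1 hx
    rw [hl]
    by_contra! hc
    have hmc : m + (-c) • 1 = t • f := by
      simp only at hxm
      rw [neg_smul, hxm]
      abel
    have hcm : m + (-c) • (1 : A) ∈ M := add_mem hm (smul_mem (by linarith) one_mem)
    rcases ht.eq_or_lt with rfl | ht
    -- Here `M` contains a negative constant, hence `-|N|`; adding `|N| + f ∈ M` gives `f ∈ M`.
    · obtain ⟨N, hN⟩ := hM (-f)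
      refine hf ?_
      have h := smul_mem (c := |N| / (-c)) (div_nonneg (abs_nonneg _) (by linarith)) hm
      have hmc' : m = c • 1 := by
        rw [zero_smul, neg_smul] at hmc
        exact add_neg_eq_zero.1 hmc
      have := add_mem h (algebraMap_sub_mem_of_le hN (le_abs_self N))
      rw [hmc', smul_smul, ← Algebra.algebraMap_eq_smul_one] at this
      rw [show |N| / -c * c = -|N| by have := hc.ne; field_simp] at this
      simpa using this
    · have := smul_mem (c := t⁻¹) (by positivity) hcm
      rw [hmc, smul_smul, inv_mul_cancel₀ ht.ne', one_smul] at this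
      exact hf this
  · intro y
    obtain ⟨N, hN⟩ := hM (-y)
    refine ⟨⟨N • 1, Submodule.smul_mem _ _ (Submodule.mem_span_singleton_self 1)⟩, ?_⟩
    refine ⟨_, hN, 0, le_rfl, ?_⟩
    simp [Algebra.algebraMap_eq_smul_one]

/-- A nonnegative sequence that is doubling log-convex and geometrically bounded satisfies the
geometric bound already at the first step. -/
theorem le_mul_of_sq_le {u : ℕ → ℝ} {c K : ℝ} (hc : 0 < c) (hu : ∀ k, 0 ≤ u k)
    (hcs : ∀ k, u k ^ 2 ≤ u 0 * u (2 * k)) (hK : ∀ k, u k ≤ K * c ^ k) : u 1 ≤ c * u 0 := by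
  rcases (hu 0).eq_or_lt with h0 | h0
  · have := hcs 1
    rw [← h0] at this ⊢
    have : u 1 = 0 := by nlinarith [hu 1]
    simp [this]
  -- After normalizing by `u 0`, repeated doubling gives `(v 1 / c) ^ 2 ^ j ≤ K / u 0` for all `j`,
  -- impossible when `v 1 > c`.
  by_contra! hlt
  set v : ℕ → ℝ := fun k => u k / u 0 with hv
  have hv0 : ∀ k, 0 ≤ v k := fun k => div_nonneg (hu k) h0.le
  have hvs : ∀ k, v k ^ 2 ≤ v (2 * k) := fun k => by
    simp only [hv]
    rw [div_pow, div_le_div_iff₀ (by positivity) h0]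
    nlinarith [hcs k]
  have hpow : ∀ j, v 1 ^ 2 ^ j ≤ v (2 ^ j) := fun j => by
    induction j with
    | zero => simp
    | succ j ih =>
      rw [pow_succ, pow_mul, pow_succ, mul_comm (2 ^ j)]
      exact (pow_le_pow_left₀ (pow_nonneg (hv0 _) _) ih 2).trans (hvs _)
  have hw : 1 < v 1 / c := by
    rw [one_lt_div hc]
    simp only [hv]
    rwa [lt_div_iff₀ h0]
  have hb : ∀ j : ℕ, (v 1 / c) ^ 2 ^ j ≤ K / u 0 := fun j => by
    rw [div_pow, div_le_iff₀ (by positivity)]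
    refine (hpow j).trans ?_
    simp only [hv]
    rw [div_mul_eq_mul_div, div_le_div_iff_of_pos_right h0]
    exact hK _
  obtain ⟨k, hk⟩ := pow_unbounded_of_one_lt (K / u 0) hw
  have h1 : (v 1 / c) ^ k ≤ (v 1 / c) ^ 2 ^ k :=
    pow_le_pow_right₀ hw.le (Nat.lt_two_pow_self).le
  linarith [hb k]

/-- The discriminant of the nonnegative quadratic `t ↦ L ((t - b)² g)`. -/
theorem states.cauchySchwarz {L : A → ℝ} (hL : L ∈ M.states) {g : A} (hg : g ∈ M) (b : A) :
    L (b * g) ^ 2 ≤ L g * L (b ^ 2 * g) := by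
  have key : ∀ t : ℝ, 0 ≤ L g * (t * t) + (-2 * L (b * g)) * t + L (b ^ 2 * g) := fun t => by
    have := hL.2.2.2 _ (sq_mul_mem (algebraMap ℝ A t - b) hg)
    rw [show (algebraMap ℝ A t - b) ^ 2 * g = algebraMap ℝ A (t * t) * g
      - algebraMap ℝ A (2 * t) * (b * g) + b ^ 2 * g by simp only [map_mul, map_ofNat]; ring,
      hL.1, states.map_sub hL, states.map_algebraMap_mul hL, states.map_algebraMap_mul hL] at this
    linarith
  have := discrim_le_zero key
  rw [discrim] at this
  nlinarith

/-- A quadratic module need not contain the product `(c - a²) g`, but states are still nonnegative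
on it. The sequence `L (a^(2k) g)` satisfies the doubling inequality by Cauchy–Schwarz and grows at
most like `c ^ k`, since `g ≤ N` and `L (a^(2k)) ≤ c ^ k`; `le_mul_of_sq_le` applies. -/
theorem states.map_sq_mul_le {L : A → ℝ} (hM : M.IsArchimedean) (hL : L ∈ M.states) {a g : A}
    {c : ℝ} (hc : 0 < c) (ha : algebraMap ℝ A c - a ^ 2 ∈ M) (hg : g ∈ M) :
    L (a ^ 2 * g) ≤ c * L g := by
  obtain ⟨N, hN⟩ := hM g
  have hpow : ∀ k : ℕ, L ((a ^ k) ^ 2) ≤ c ^ k := fun k => by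
    induction k with
    | zero => simp [hL.2.2.1]
    | succ k ih =>
      have := hL.2.2.2 _ (sq_mul_mem (a ^ k) ha)
      rw [show (a ^ k) ^ 2 * (algebraMap ℝ A c - a ^ 2) =
        algebraMap ℝ A c * (a ^ k) ^ 2 - (a ^ (k + 1)) ^ 2 by ring, states.map_sub hL,
        states.map_algebraMap_mul hL] at this
      rw [pow_succ c]
      nlinarith
  have := le_mul_of_sq_le (u := fun k => L ((a ^ k) ^ 2 * g)) (K := |N|) hc
    (fun k => hL.2.2.2 _ (sq_mul_mem _ hg)) (fun k => ?_) (fun k => ?_)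
  · simpa using this
  · have := states.cauchySchwarz hL hg ((a ^ k) ^ 2)
    simp only [pow_zero, one_pow, one_mul]
    rwa [show ((a ^ k) ^ 2) ^ 2 = (a ^ (2 * k)) ^ 2 by ring] at this
  · have := hL.2.2.2 _ (sq_mul_mem (a ^ k) hN)
    rw [show (a ^ k) ^ 2 * (algebraMap ℝ A N - g) =
        algebraMap ℝ A N * (a ^ k) ^ 2 - (a ^ k) ^ 2 * g by ring, states.map_sub hL,
        states.map_algebraMap_mul hL] at this
    have h0 := hL.2.2.2 _ (sq_mem (a ^ k))
    calc L ((a ^ k) ^ 2 * g) ≤ N * L ((a ^ k) ^ 2) := by linarith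
      _ ≤ |N| * L ((a ^ k) ^ 2) := by gcongr; exact le_abs_self N
      _ ≤ |N| * c ^ k := by gcongr; exact hpow k

/-- With `t = L (a²)`, `L` is the convex combination, with weights `t` and `1 - t`, of the
normalizations of `b ↦ L (a² b)` and `b ↦ L ((1 - a²) b)`. Both are states, the second by
`states.map_sq_mul_le`, so extremality equates the first with `L`. The bound `1/2` keeps `1 - t`
positive. -/
theorem states.map_sq_mul_of_small {L : A → ℝ} (hM : M.IsArchimedean)
    (hL : L ∈ M.states.extremePoints ℝ) {a : A}
    (ha : algebraMap ℝ A (1 / 2) - a ^ 2 ∈ M) (b : A) : L (a ^ 2 * b) = L (a ^ 2) * L b := by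
  obtain ⟨hLs, hext⟩ := mem_extremePoints_iff_left.1 hL
  have ht0 : 0 ≤ L (a ^ 2) := hLs.2.2.2 _ (sq_mem a)
  have ht1 : L (a ^ 2) ≤ 1 / 2 := by
    have := hLs.2.2.2 _ ha
    rw [states.map_sub hLs, states.map_algebraMap hLs] at this
    linarith
  set t := L (a ^ 2) with ht
  rcases ht0.eq_or_lt with h0 | h0
  -- If `t = 0` there is nothing to normalize; boundedness of `b` and `-b` forces `L (a² b) = 0`.
  · have hle : ∀ b, L (a ^ 2 * b) ≤ 0 := fun b => by
      obtain ⟨N, hN⟩ := hM b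
      have := hLs.2.2.2 _ (sq_mul_mem a hN)
      rw [show a ^ 2 * (algebraMap ℝ A N - b) = algebraMap ℝ A N * a ^ 2 - a ^ 2 * b by ring,
        states.map_sub hLs, states.map_algebraMap_mul hLs, ← ht, ← h0] at this
      linarith
    have h1 := hle b
    have h2 := hle (-b)
    rw [mul_neg, states.map_neg hLs] at h2
    rw [← h0]
    linarith
  · have h1 : 0 < 1 - t := by linarith
    have hx : (fun b => t⁻¹ * L (a ^ 2 * b)) ∈ M.states := by
      refine ⟨fun b c => ?_, fun c b => ?_, ?_, fun b hb => ?_⟩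
      · simp only [mul_add, hLs.1]
      · simp only [mul_smul_comm, hLs.2.1]
        ring
      · simp only [mul_one, ← ht]
        exact inv_mul_cancel₀ h0.ne'
      · exact mul_nonneg (by positivity) (hLs.2.2.2 _ (sq_mul_mem a hb))
    have hy : (fun b => (1 - t)⁻¹ * (L b - L (a ^ 2 * b))) ∈ M.states := by
      refine ⟨fun b c => ?_, fun c b => ?_, ?_, fun b hb => ?_⟩
      · simp only [mul_add, hLs.1]
        ring
      · simp only [mul_smul_comm, hLs.2.1]
        ring
      · simp only [mul_one, ← ht, hLs.2.2.1]
        exact inv_mul_cancel₀ h1.ne'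
      · refine mul_nonneg (by positivity) ?_
        have h2 := states.map_sq_mul_le hM hLs (by norm_num) ha hb
        have h3 := hLs.2.2.2 _ hb
        linarith
    have := hext _ hx _ hy ⟨t, 1 - t, h0, h1, by ring, ?_⟩
    · have := congrFun this b
      field_simp at this
      linarith
    · ext c
      simp only [Pi.add_apply, Pi.smul_apply, smul_eq_mul]
      field_simp
      ring

/-- Scaling reduces squares to the small case, and `4a = (a + 1)² - (a - 1)²` reduces arbitrary
elements to squares. -/
theorem states.map_mul {L : A → ℝ} (hM : M.IsArchimedean)
    (hL : L ∈ M.states.extremePoints ℝ) (a b : A) : L (a * b) = L a * L b := by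
  have hLs := hL.1
  have hsq : ∀ a, L (a ^ 2 * b) = L (a ^ 2) * L b := fun a => by
    obtain ⟨N, hN⟩ := hM (a ^ 2)
    have hN' : algebraMap ℝ A (|N| + 1) - a ^ 2 ∈ M :=
      algebraMap_sub_mem_of_le hN (by linarith [le_abs_self N])
    have hpos : 0 < |N| + 1 := by positivity
    set s : ℝ := Real.sqrt (1 / (2 * (|N| + 1))) with hs
    have hs2 : s ^ 2 = 1 / (2 * (|N| + 1)) := Real.sq_sqrt (by positivity)
    have hs0 : s ^ 2 ≠ 0 := by rw [hs2]; positivity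
    have h := states.map_sq_mul_of_small hM hL (a := algebraMap ℝ A s * a) ?_ b
    · rw [show (algebraMap ℝ A s * a) ^ 2 = algebraMap ℝ A (s ^ 2) * a ^ 2 by
        rw [map_pow]; ring, mul_assoc, states.map_algebraMap_mul hLs,
        states.map_algebraMap_mul hLs, mul_assoc] at h
      exact mul_left_cancel₀ hs0 h
    · have := smul_mem (sq_nonneg s) hN'
      rw [Algebra.smul_def, mul_sub, ← _root_.map_mul] at this
      rw [show s ^ 2 * (|N| + 1) = 1 / 2 by rw [hs2]; field_simp] at this
      rwa [mul_pow, ← map_pow]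
  have h4 : (4 : ℝ) • a = (a + 1) ^ 2 - (a - 1) ^ 2 := by
    rw [Algebra.smul_def, map_ofNat]
    ring
  have h5 : L ((4 : ℝ) • a * b) = L ((4 : ℝ) • a) * L b := by
    rw [h4, sub_mul, states.map_sub hLs, states.map_sub hLs, hsq, hsq, sub_mul]
  rw [smul_mul_assoc, hLs.2.1, hLs.2.1] at h5
  linarith

/-- **Representation theorem** for Archimedean quadratic modules: an element that is positive at
every character which is nonnegative on the module belongs to the module. -/
theorem mem_of_forall_pos [Nontrivial A] (hM : M.IsArchimedean) {f : A}
    (hf : ∀ χ : A →ₐ[ℝ] ℝ, (∀ a ∈ M, 0 ≤ χ a) → 0 < χ f) : f ∈ M := by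
  by_contra hfM
  obtain ⟨L₀, hL₀, hL₀f⟩ := exists_state_nonpos hM hfM
  have hcpt := isCompact_states hM
  obtain ⟨L₁, hL₁, hmin⟩ := hcpt.exists_isMinOn ⟨L₀, hL₀⟩ (continuous_apply f).continuousOn
  -- The exposed face on which `L f` is minimal; its extreme points are extreme among all states.
  let F : Set (A → ℝ) := {L ∈ M.states | ∀ L' ∈ M.states,
    (-ContinuousLinearMap.proj (R := ℝ) (φ := fun _ : A => ℝ) f) L' ≤
      (-ContinuousLinearMap.proj (R := ℝ) (φ := fun _ : A => ℝ) f) L}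
  have hF : IsExposed ℝ M.states F := fun _ => ⟨_, rfl⟩
  have hFne : F.Nonempty := ⟨L₁, hL₁, fun L' hL' => by simpa using hmin hL'⟩
  obtain ⟨L, hL⟩ := (hF.isCompact hcpt).extremePoints_nonempty hFne
  have hLe := hF.isExtreme.extremePoints_subset_extremePoints hL
  have hLs := hLe.1
  have hLf : L f ≤ 0 := by
    have := hL.1.2 L₀ hL₀
    simp only [neg_apply, ContinuousLinearMap.proj_apply] at this
    linarith
  let χ : A →ₐ[ℝ] ℝ := AlgHom.ofLinearMap (states.toLinearMap hLs) hLs.2.2.1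
    (states.map_mul hM hLe)
  exact absurd (hf χ fun a ha => hLs.2.2.2 a ha) (not_lt.2 hLf)

end QuadraticModule

/-! ### Putinar's Positivstellensatz and polynomial approximation. -/

section SosModule

variable {τ ι : Type*} [Fintype ι]

/-- The quadratic module `Σ² + ∑ⱼ Σ² hⱼ` generated by finitely many polynomials. -/
def sosModule (h : ι → MvPolynomial τ ℝ) : QuadraticModule (MvPolynomial τ ℝ) where
  carrier := {f | ∃ (s₀ : MvPolynomial τ ℝ) (s : ι → MvPolynomial τ ℝ), IsSumSq s₀ ∧
    (∀ j, IsSumSq (s j)) ∧ f = s₀ + ∑ j, s j * h j}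
  zero_mem' := ⟨0, 0, .zero, fun _ => .zero, by simp⟩
  add_mem' := by
    rintro _ _ ⟨s₀, s, hs₀, hs, rfl⟩ ⟨t₀, t, ht₀, ht, rfl⟩
    refine ⟨s₀ + t₀, s + t, hs₀.add ht₀, fun j => (hs j).add (ht j), ?_⟩
    simp only [Pi.add_apply, add_mul, Finset.sum_add_distrib]
    ring
  one_mem' := ⟨1, 0, .one, fun _ => .zero, by simp⟩
  sq_mul_mem' := by
    rintro a _ ⟨s₀, s, hs₀, hs, rfl⟩
    have ha : IsSumSq (a ^ 2) := by
      rw [sq]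
      exact .mul_self a
    refine ⟨a ^ 2 * s₀, fun j => a ^ 2 * s j, ha.mul hs₀, fun j => ha.mul (hs j), ?_⟩
    simp only [mul_add, Finset.mul_sum, mul_assoc]

theorem mem_sosModule {h : ι → MvPolynomial τ ℝ} {f : MvPolynomial τ ℝ} :
    f ∈ sosModule h ↔ ∃ (s₀ : MvPolynomial τ ℝ) (s : ι → MvPolynomial τ ℝ), IsSumSq s₀ ∧
      (∀ j, IsSumSq (s j)) ∧ f = s₀ + ∑ j, s j * h j := Iff.rfl

theorem generator_mem_sosModule (h : ι → MvPolynomial τ ℝ) (j : ι) : h j ∈ sosModule h := by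
  classical
  refine ⟨0, Pi.single j 1, .zero, fun i => ?_, ?_⟩
  · by_cases hij : i = j
    · subst hij
      simp [IsSumSq.one]
    · simp [Pi.single_eq_of_ne hij, IsSumSq.zero]
  · simp [Pi.single_apply]

theorem IsSumSq.eval_nonneg {f : MvPolynomial τ ℝ} (hf : IsSumSq f) (x : τ → ℝ) :
    0 ≤ eval x f := by
  induction hf with
  | zero => simp
  | sq_add a _ ih =>
    rw [map_add, map_mul]
    exact add_nonneg (mul_self_nonneg _) ih

/-- **Putinar's Positivstellensatz**: if the squares of all variables are bounded modulo the
quadratic module, then it contains every polynomial that is positive on the semialgebraic set. -/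
theorem putinar (h : ι → MvPolynomial τ ℝ)
    (hb : ∀ i : τ, ∃ N : ℝ, 0 ≤ N ∧ C N - X i ^ 2 ∈ sosModule h) {f : MvPolynomial τ ℝ}
    (hf : ∀ x : τ → ℝ, (∀ j, 0 ≤ eval x (h j)) → 0 < eval x f) : f ∈ sosModule h := by
  refine QuadraticModule.mem_of_forall_pos
    (QuadraticModule.isArchimedean_of_boundedElements_eq_top ?_) fun χ hχ => ?_
  · rw [eq_top_iff, ← MvPolynomial.adjoin_range_X, Algebra.adjoin_le_iff]
    rintro _ ⟨i, rfl⟩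
    exact hb i
  -- Characters of a polynomial algebra are point evaluations.
  · have hev : ∀ p, χ p = eval (fun i => χ (X i)) p := fun p => by
      rw [← MvPolynomial.coe_aeval_eq_eval]
      exact DFunLike.congr_fun (MvPolynomial.algHom_ext (f := χ)
        (g := aeval fun i => χ (X i)) fun i => by simp) p
    rw [hev]
    exact hf _ fun j => by
      rw [← hev]
      exact hχ _ (generator_mem_sosModule h j)

end SosModule

/-- Polynomials are uniformly dense in the continuous functions on a compact subset of `ℝⁿ`. -/
theorem exists_mvPolynomial_near {τ : Type*} {K : Set (τ → ℝ)} (hK : IsCompact K)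
    {F : (τ → ℝ) → ℝ} (hF : Continuous F) {ε : ℝ} (hε : 0 < ε) :
    ∃ p : MvPolynomial τ ℝ, ∀ x ∈ K, |eval x p - F x| < ε := by
  let Θ : MvPolynomial τ ℝ →ₐ[ℝ] C(τ → ℝ, ℝ) :=
    aeval fun i => (⟨fun x => x i, continuous_apply i⟩ : C(τ → ℝ, ℝ))
  have hΘ : ∀ p x, Θ p x = eval x p := fun p x => by
    induction p using MvPolynomial.induction_on with
    | C a => simp [Θ]
    | add p q hp hq => simp [hp, hq]
    | mul_X p i hp =>
      rw [map_mul, ContinuousMap.mul_apply, hp, map_mul]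
      simp [Θ]
  obtain ⟨g, ⟨p, rfl⟩, hg⟩ :=
    ContinuousMap.exists_mem_subalgebra_near_continuous_of_isCompact_of_separatesPoints
      (A := Θ.range) (fun x y hxy => by
        obtain ⟨i, hi⟩ := Function.ne_iff.1 hxy
        exact ⟨Θ (X i), ⟨Θ (X i), ⟨X i, rfl⟩, rfl⟩, by simpa [hΘ] using hi⟩) ⟨F, hF⟩ hK hε
  exact ⟨p, fun x hx => by simpa [hΘ] using hg x hx⟩

/-! ### Upper envelopes of compact sets. -/

section UpperEnvelope

variable {E : Type*} [MetricSpace E]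

/-- The Lipschitz regularization of the upper envelope of a set `K` of pairs `(x, z)`. -/
noncomputable def lipschitzEnvelope (K : Set (E × ℝ)) (k : ℕ) (x : E) : ℝ :=
  sSup ((fun w : E × ℝ => w.2 - k * dist x w.1) '' K)

variable {K : Set (E × ℝ)}

theorem continuous_lipschitzEnvelope (hK : IsCompact K) (k : ℕ) :
    Continuous (lipschitzEnvelope K k) :=
  hK.continuous_sSup (f := fun (x : E) (w : E × ℝ) => w.2 - k * dist x w.1) (by
    simp only [Function.HasUncurry.uncurry, id]
    fun_prop)

theorem le_lipschitzEnvelope (hK : IsCompact K) (k : ℕ) (x : E) {w : E × ℝ} (hw : w ∈ K) :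
    w.2 - k * dist x w.1 ≤ lipschitzEnvelope K k x :=
  le_csSup (hK.image (by fun_prop)).bddAbove ⟨w, hw, rfl⟩

theorem upperEnvelope_le_lipschitzEnvelope (hK : IsCompact K) (k : ℕ) {x : E}
    (hx : ∃ z, (x, z) ∈ K) : sSup {z | (x, z) ∈ K} ≤ lipschitzEnvelope K k x :=
  csSup_le hx fun z hz => by simpa using le_lipschitzEnvelope hK k x hz

theorem le_upperEnvelope (hK : IsCompact K) {w : E × ℝ} (hw : w ∈ K) :
    w.2 ≤ sSup {z | (w.1, z) ∈ K} := by
  refine le_csSup ?_ hw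
  refine (hK.image continuous_snd).bddAbove.mono ?_
  intro z hz
  exact ⟨_, hz, rfl⟩

/-- Points of `K` of height at least `s + ε/2` form a compact set missing the fiber over `x`, so
they lie at horizontal distance at least some `δ > 0`. Once `k δ > B - s`, the penalty brings them
below `s`. -/
theorem tendsto_lipschitzEnvelope (hK : IsCompact K) {x : E} (hx : ∃ z, (x, z) ∈ K) :
    Tendsto (fun k => lipschitzEnvelope K k x) atTop (𝓝 (sSup {z | (x, z) ∈ K})) := by
  set s := sSup {z | (x, z) ∈ K} with hs
  have hne : K.Nonempty := hx.imp' (fun z => (x, z)) fun _ h => h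
  obtain ⟨B, hB⟩ := (hK.image continuous_snd).bddAbove
  rw [Metric.tendsto_atTop]
  intro ε hε
  have hK' : IsCompact (K ∩ {w | s + ε / 2 ≤ w.2}) :=
    hK.inter_right (isClosed_le (by fun_prop) (by fun_prop))
  obtain ⟨δ, hδ, hδw⟩ : ∃ δ > 0, ∀ w ∈ K ∩ {w | s + ε / 2 ≤ w.2}, δ ≤ dist x w.1 := by
    refine hK'.exists_forall_le' (by fun_prop) fun w hw => ?_
    rw [dist_pos]
    rintro rfl
    have := le_upperEnvelope hK hw.1
    have h2 : s + ε / 2 ≤ w.2 := hw.2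
    rw [← hs] at this
    linarith
  obtain ⟨k₀, hk₀⟩ := exists_nat_gt ((B - s) / δ)
  refine ⟨k₀, fun k hk => ?_⟩
  have h1 := upperEnvelope_le_lipschitzEnvelope hK k hx
  have h2 : lipschitzEnvelope K k x ≤ s + ε / 2 := by
    refine csSup_le (hne.image _) ?_
    rintro _ ⟨w, hw, rfl⟩
    simp only
    by_cases h : s + ε / 2 ≤ w.2
    · have hd := hδw w ⟨hw, h⟩
      have hwB : w.2 ≤ B := hB ⟨w, hw, rfl⟩
      rw [div_lt_iff₀ hδ] at hk₀
      have : (k₀ : ℝ) * δ ≤ k * dist x w.1 := by gcongr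
      linarith
    · have : 0 ≤ (k : ℝ) * dist x w.1 := by positivity
      linarith
  rw [Real.dist_eq, abs_lt]
  constructor <;> linarith

theorem exists_abs_lipschitzEnvelope_le (hK : IsCompact K) : ∃ B, ∀ k, ∀ x : E,
    (∃ z, (x, z) ∈ K) → |lipschitzEnvelope K k x| ≤ B := by
  obtain ⟨B, hB⟩ := (hK.image continuous_snd).isBounded.exists_norm_le
  have hB' : ∀ w ∈ K, |w.2| ≤ B := fun w hw => hB _ ⟨w, hw, rfl⟩
  refine ⟨B, fun k x ⟨z, hz⟩ => abs_le.2 ⟨?_, ?_⟩⟩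
  · have h1 := le_lipschitzEnvelope hK k x hz
    have h2 := (abs_le.1 (hB' _ hz)).1
    simp only [dist_self, mul_zero, sub_zero] at h1 h2
    linarith
  · refine csSup_le (Set.Nonempty.image _ ⟨_, hz⟩) ?_
    rintro _ ⟨w, hw, rfl⟩
    have h2 := (abs_le.1 (hB' _ hw)).2
    have : 0 ≤ (k : ℝ) * dist x w.1 := by positivity
    simp only
    linarith

variable [MeasurableSpace E] [BorelSpace E]

/-- Measurability comes from being an a.e. limit of continuous functions. -/
theorem integrable_upperEnvelope (hK : IsCompact K) (μ : Measure E) [IsFiniteMeasure μ]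
    (hμ : ∀ᵐ x ∂μ, ∃ z, (x, z) ∈ K) : Integrable (fun x => sSup {z | (x, z) ∈ K}) μ := by
  obtain ⟨B, hB⟩ := exists_abs_lipschitzEnvelope_le hK
  have hlim : ∀ᵐ x ∂μ, Tendsto (fun k => lipschitzEnvelope K k x) atTop
      (𝓝 (sSup {z | (x, z) ∈ K})) := hμ.mono fun x hx => tendsto_lipschitzEnvelope hK hx
  refine Integrable.of_bound (C := B) (aestronglyMeasurable_of_tendsto_ae atTop
    (fun k => (continuous_lipschitzEnvelope hK k).aestronglyMeasurable) hlim) ?_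
  filter_upwards [hμ, hlim] with x hx hl
  exact le_of_tendsto hl.norm (Eventually.of_forall fun k => hB k x hx)

/-- The integral of the upper envelope of a compact set is approximated by integrals of continuous
majorants. -/
theorem exists_continuous_ge_upperEnvelope (hK : IsCompact K) (μ : Measure E) [IsFiniteMeasure μ]
    (hμ : ∀ᵐ x ∂μ, ∃ z, (x, z) ∈ K) {ε : ℝ} (hε : 0 < ε) :
    ∃ F : E → ℝ, Continuous F ∧ (∀ w ∈ K, w.2 ≤ F w.1) ∧
      ∫ x, F x ∂μ < ∫ x, sSup {z | (x, z) ∈ K} ∂μ + ε := by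
  obtain ⟨B, hB⟩ := exists_abs_lipschitzEnvelope_le hK
  have h := tendsto_integral_of_dominated_convergence (μ := μ)
    (F := fun k => lipschitzEnvelope K k) (f := fun x => sSup {z | (x, z) ∈ K}) (fun _ => B)
    (fun k => (continuous_lipschitzEnvelope hK k).aestronglyMeasurable) (integrable_const B)
    (fun k => hμ.mono fun x hx => hB k x hx)
    (hμ.mono fun x hx => tendsto_lipschitzEnvelope hK hx)
  obtain ⟨k, hk⟩ := (h.eventually_lt_const (lt_add_of_pos_right _ hε)).exists
  exact ⟨_, continuous_lipschitzEnvelope hK k, fun w hw => by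
    simpa using le_lipschitzEnvelope hK k w.1 hw, hk⟩

end UpperEnvelope

/-! ### Evaluation in `ℝ[x, y, z]`, the cube and its measure. -/

/-- The point `(x, y, z)` as a valuation of the variables of `ℝ[x, y, z]`. -/
def xyzPoint {n : ℕ} (x y : Fin n → ℝ) (z : ℝ) : XYZ n → ℝ := Sum.elim x (Sum.elim y fun _ => z)

@[simp] theorem eval_xyzPoint_inX {n : ℕ} (x y : Fin n → ℝ) (z : ℝ) (f : MvPolynomial (Fin n) ℝ) :
    eval (xyzPoint x y z) (inX f) = eval x f := by
  rw [inX, eval_rename]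
  rfl

@[simp] theorem eval_xyzPoint_inY {n : ℕ} (x y : Fin n → ℝ) (z : ℝ) (f : MvPolynomial (Fin n) ℝ) :
    eval (xyzPoint x y z) (inY f) = eval y f := by
  rw [inY, eval_rename]
  rfl

@[simp] theorem eval_xyzPoint_varZ {n : ℕ} (x y : Fin n → ℝ) (z : ℝ) :
    eval (xyzPoint x y z) (varZ n) = z := by
  simp [varZ, xyzPoint]

theorem exists_eq_xyzPoint {n : ℕ} (w : XYZ n → ℝ) : ∃ x y z, w = xyzPoint x y z := by
  refine ⟨fun i => w (.inl i), fun i => w (.inr (.inl i)), w (.inr (.inr ())), ?_⟩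
  ext (i | i | i) <;> rfl

theorem cube_eq_pi (n : ℕ) : cube n = Set.univ.pi fun _ => Set.Icc (-1 : ℝ) 1 := by
  ext x
  simp only [cube, Set.mem_univ_pi]
  rfl

theorem isCompact_cube (n : ℕ) : IsCompact (cube n) := by
  rw [cube_eq_pi]
  exact isCompact_univ_pi fun _ => isCompact_Icc

theorem mem_cube_iff_sq {n : ℕ} {x : Fin n → ℝ} : x ∈ cube n ↔ ∀ j, 0 ≤ 1 - x j ^ 2 := by
  refine forall_congr' fun j => ?_
  rw [Set.mem_Icc, ← abs_le, ← sq_le_one_iff_abs_le_one, sub_nonneg]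

instance (n : ℕ) : IsFiniteMeasure (cubeMeasure n) := by
  have : IsFiniteMeasure (volume.restrict (cube n)) :=
    ⟨by simpa using (isCompact_cube n).measure_lt_top⟩
  have h : ((2 : ENNReal) ^ n)⁻¹ ≠ ⊤ := by simp
  exact Measure.smul_finite _ h

theorem measureReal_cubeMeasure_univ (n : ℕ) : (cubeMeasure n).real Set.univ = 1 := by
  have hv : volume (cube n) = (2 : ENNReal) ^ n := by
    rw [cube_eq_pi, volume_pi_pi]
    norm_num
  rw [Measure.real, cubeMeasure, Measure.smul_apply, Measure.restrict_apply_univ, hv, smul_eq_mul,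
    ENNReal.inv_mul_cancel (by simp) (by simp), ENNReal.toReal_one]

theorem ae_mem_cube (n : ℕ) : ∀ᵐ x ∂(cubeMeasure n), x ∈ cube n :=
  Measure.ae_smul_measure (ae_restrict_mem (isCompact_cube n).measurableSet) _

theorem integrable_cubeMeasure_of_continuous {n : ℕ} {F : (Fin n → ℝ) → ℝ} (hF : Continuous F) :
    Integrable F (cubeMeasure n) := by
  obtain ⟨B, hB⟩ := ((isCompact_cube n).image hF).isBounded.exists_norm_le
  exact Integrable.of_bound hF.aestronglyMeasurable B
    ((ae_mem_cube n).mono fun x hx => hB _ ⟨x, hx, rfl⟩)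

theorem integrable_cubeMeasure_eval {n : ℕ} (φ : MvPolynomial (Fin n) ℝ) :
    Integrable (fun x => eval x φ) (cubeMeasure n) :=
  integrable_cubeMeasure_of_continuous φ.continuous_eval

/-! ### Convergence of the optimal values and of nearly optimal solutions. -/

namespace RationalVectorProblem

variable {n m r : ℕ} (P : RationalVectorProblem n m r) {fLower fUpper : ℝ}

theorem IsCertified.eval_nonneg {P : RationalVectorProblem n m r} {h : MvPolynomial (Fin n) ℝ}
    (hh : P.IsCertified h) {x : Fin n → ℝ} (hx : x ∈ P.feasibleSet) (hxc : x ∈ cube n) :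
    0 ≤ eval x h := by
  obtain ⟨k, s₀, s, t, hs₀, hs, ht, -, -, -, rfl⟩ := hh
  simp only [map_add, map_sum, map_mul, map_sub, map_one, map_pow, eval_X]
  refine add_nonneg (add_nonneg (hs₀.eval_nonneg x) ?_) ?_
  · exact Finset.sum_nonneg fun j _ => mul_nonneg ((hs j).eval_nonneg x) (hx j)
  · exact Finset.sum_nonneg fun j _ =>
      mul_nonneg ((ht j).eval_nonneg x) (mem_cube_iff_sq.1 hxc j)

/-- Both certificates are evaluated at one point of `Ω` for one index. The inequality is what allows
the interval for `z` to be encoded by a single quadratic constraint. -/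
theorem iInf_le_iSup_of_isCertified (hm : 0 < m) (hΩ : P.feasibleSet.Nonempty)
    (hΩΔ : P.feasibleSet ⊆ cube n) (hq : ∀ i, ∀ x ∈ P.feasibleSet, 0 < eval x (P.q i))
    (lower upper : Fin m → ℝ) (hlower : ∀ i, P.IsCertified (P.p i - C (lower i) * P.q i))
    (hupper : ∀ i, P.IsCertified (C (upper i) * P.q i - P.p i)) :
    ⨅ i, lower i ≤ ⨆ i, upper i := by
  obtain ⟨x, hx⟩ := hΩ
  let i : Fin m := ⟨0, hm⟩
  have h1 := (hlower i).eval_nonneg hx (hΩΔ hx)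
  have h2 := (hupper i).eval_nonneg hx (hΩΔ hx)
  simp only [map_sub, map_mul, eval_C] at h1 h2
  have h3 : lower i ≤ upper i := le_of_mul_le_mul_right (by linarith) (hq i x hx)
  exact (ciInf_le (Set.finite_range lower).bddBelow i).trans
    (h3.trans (le_ciSup (Set.finite_range upper).bddAbove i))

theorem forall_constraint_nonneg_iff (hle : fLower ≤ fUpper) (hΩΔ : P.feasibleSet ⊆ cube n)
    {x y : Fin n → ℝ} {z : ℝ} :
    (∀ j, 0 ≤ eval (xyzPoint x y z) (P.constraint fLower fUpper j)) ↔
      x ∈ cube n ∧ (y, z) ∈ P.fiber fLower fUpper x := by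
  have hz : 0 ≤ (fUpper - fLower) ^ 2 - z ^ 2 ↔ z ∈ Set.Icc (fLower - fUpper) (fUpper - fLower) := by
    rw [sub_nonneg, sq_le_sq, abs_of_nonneg (sub_nonneg.2 hle), abs_le, Set.mem_Icc, neg_sub]
  simp only [Sum.forall, constraint, map_sub, map_mul, map_pow, map_one, eval_C, eval_X,
    eval_xyzPoint_inX, eval_xyzPoint_inY, eval_xyzPoint_varZ, fiber, Set.mem_ofPred_eq,
    ← mem_cube_iff_sq, hz, forall_const]
  constructor
  · rintro ⟨h1, ⟨h2, -⟩, h4, h5⟩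
    exact ⟨h4, h2, h5, h1⟩
  · rintro ⟨h4, h2, h5, h1⟩
    exact ⟨h1, ⟨h2, hΩΔ h2⟩, h4, h5⟩

/-- The pairs `(x, z)` such that `x ∈ Δ` and `(y, z) ∈ 𝐊ₓ` for some `y`. -/
def projectedGraph (fLower fUpper : ℝ) : Set ((Fin n → ℝ) × ℝ) :=
  {w | w.1 ∈ cube n ∧ ∃ y, (y, w.2) ∈ P.fiber fLower fUpper w.1}

/-- It is the projection, forgetting `y`, of a closed subset of a compact box. -/
theorem isCompact_projectedGraph (hΩc : IsCompact P.feasibleSet) :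
    IsCompact (P.projectedGraph fLower fUpper) := by
  let T : Set ((Fin n → ℝ) × (Fin n → ℝ) × ℝ) :=
    {w | w.1 ∈ cube n ∧ w.2 ∈ P.fiber fLower fUpper w.1}
  have hT : T = (cube n ×ˢ P.feasibleSet ×ˢ Set.Icc (fLower - fUpper) (fUpper - fLower)) ∩
      ⋂ i, {w | 0 ≤ eval w.1 (P.p i) * eval w.2.1 (P.q i) - eval w.2.1 (P.p i) * eval w.1 (P.q i)
        - w.2.2 * eval w.1 (P.q i) * eval w.2.1 (P.q i)} := by
    ext ⟨x, y, z⟩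
    simp only [T, fiber, Set.mem_ofPred_eq, Set.mem_inter_iff, Set.mem_prod, Set.mem_iInter]
    tauto
  have hTc : IsCompact T := by
    rw [hT]
    refine ((isCompact_cube n).prod (hΩc.prod isCompact_Icc)).inter_right
      (isClosed_iInter fun i => isClosed_le continuous_const ?_)
    have hx : ∀ p : MvPolynomial (Fin n) ℝ, Continuous
        fun w : (Fin n → ℝ) × (Fin n → ℝ) × ℝ => eval w.1 p := fun p =>
      p.continuous_eval.comp continuous_fst
    have hy : ∀ p : MvPolynomial (Fin n) ℝ, Continuous
        fun w : (Fin n → ℝ) × (Fin n → ℝ) × ℝ => eval w.2.1 p := fun p =>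
      p.continuous_eval.comp (continuous_fst.comp continuous_snd)
    exact (((hx _).mul (hy _)).sub ((hy _).mul (hx _))).sub
      (((continuous_snd.comp continuous_snd).mul (hx _)).mul (hy _))
  have : P.projectedGraph fLower fUpper = (fun w => (w.1, w.2.2)) '' T := by
    ext w
    constructor
    · rintro ⟨hx, y, hy⟩
      exact ⟨(w.1, y, w.2), ⟨hx, hy⟩, rfl⟩
    · rintro ⟨⟨x, y, z⟩, ⟨hx, hy⟩, rfl⟩
      exact ⟨hx, y, hy⟩
  rw [this]
  exact hTc.image (by fun_prop)

theorem psiTilde_eq_upperEnvelope {x : Fin n → ℝ} (hx : x ∈ cube n) :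
    P.psiTilde fLower fUpper x = sSup {z | (x, z) ∈ P.projectedGraph fLower fUpper} := by
  rw [psiTilde]
  congr 1
  ext z
  simp [projectedGraph, hx]

theorem exists_mem_projectedGraph (hK : ∀ x ∈ cube n, (P.fiber fLower fUpper x).Nonempty)
    {x : Fin n → ℝ} (hx : x ∈ cube n) : ∃ z, (x, z) ∈ P.projectedGraph fLower fUpper := by
  obtain ⟨⟨y, z⟩, h⟩ := hK x hx
  exact ⟨z, hx, y, h⟩

theorem integrable_psiTilde (hΩc : IsCompact P.feasibleSet)
    (hK : ∀ x ∈ cube n, (P.fiber fLower fUpper x).Nonempty) :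
    Integrable (P.psiTilde fLower fUpper) (cubeMeasure n) :=
  (integrable_upperEnvelope (P.isCompact_projectedGraph hΩc) (cubeMeasure n)
    ((ae_mem_cube n).mono fun _ hx => P.exists_mem_projectedGraph hK hx)).congr
    ((ae_mem_cube n).mono fun _ hx => (P.psiTilde_eq_upperEnvelope hx).symm)

theorem IsFeasible.mono {P : RationalVectorProblem n m r} {k l : ℕ} (hkl : k ≤ l)
    {φ : MvPolynomial (Fin n) ℝ} {s₀ : MvPolynomial (XYZ n) ℝ}
    {s : ConstraintIndex n m r → MvPolynomial (XYZ n) ℝ}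
    (h : P.IsFeasible fLower fUpper k φ s₀ s) : P.IsFeasible fLower fUpper l φ s₀ s := by
  obtain ⟨h1, h2, h3, h4, h5, h6⟩ := h
  have hkl' : 2 * k ≤ 2 * l := by lia
  exact ⟨h1.trans hkl', h2, h3, h4, h5.trans hkl', fun j => (h6 j).trans hkl'⟩

theorem IsFeasible.psiTilde_le {P : RationalVectorProblem n m r} (hle : fLower ≤ fUpper)
    (hΩΔ : P.feasibleSet ⊆ cube n) (hK : ∀ x ∈ cube n, (P.fiber fLower fUpper x).Nonempty) {k : ℕ}
    {φ : MvPolynomial (Fin n) ℝ} {s₀ : MvPolynomial (XYZ n) ℝ}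
    {s : ConstraintIndex n m r → MvPolynomial (XYZ n) ℝ}
    (h : P.IsFeasible fLower fUpper k φ s₀ s) {x : Fin n → ℝ} (hx : x ∈ cube n) :
    P.psiTilde fLower fUpper x ≤ eval x φ := by
  obtain ⟨-, h2, h3, h4, -, -⟩ := h
  refine csSup_le ((hK x hx).image _) ?_
  rintro _ ⟨⟨y, z⟩, hyz, rfl⟩
  have hc := (P.forall_constraint_nonneg_iff hle hΩΔ).2 ⟨hx, hyz⟩
  have := congrArg (eval (xyzPoint x y z)) h4
  simp only [map_sub, map_add, map_sum, map_mul, eval_xyzPoint_inX, eval_xyzPoint_varZ] at this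
  have h0 := h2.eval_nonneg (xyzPoint x y z)
  have h5 : 0 ≤ ∑ j, eval (xyzPoint x y z) (s j) *
      eval (xyzPoint x y z) (P.constraint fLower fUpper j) :=
    Finset.sum_nonneg fun j _ => mul_nonneg ((h3 j).eval_nonneg _) (hc j)
  simp only
  linarith

theorem IsFeasible.integral_psiTilde_le {P : RationalVectorProblem n m r} (hle : fLower ≤ fUpper)
    (hΩc : IsCompact P.feasibleSet) (hΩΔ : P.feasibleSet ⊆ cube n)
    (hK : ∀ x ∈ cube n, (P.fiber fLower fUpper x).Nonempty) {k : ℕ}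
    {φ : MvPolynomial (Fin n) ℝ} {s₀ : MvPolynomial (XYZ n) ℝ}
    {s : ConstraintIndex n m r → MvPolynomial (XYZ n) ℝ}
    (h : P.IsFeasible fLower fUpper k φ s₀ s) :
    ∫ x, P.psiTilde fLower fUpper x ∂(cubeMeasure n) ≤ ∫ x, eval x φ ∂(cubeMeasure n) :=
  integral_mono_ae (P.integrable_psiTilde hΩc hK) (integrable_cubeMeasure_eval φ)
    ((ae_mem_cube n).mono fun _ hx => h.psiTilde_le hle hΩΔ hK hx)

/-- The bounds are themselves generators; this is the purpose of `1 - y_j²`, which is redundant for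
the set when `Ω ⊆ Δ`. -/
theorem bounded_variables (i : XYZ n) : ∃ N : ℝ, 0 ≤ N ∧
    C N - X i ^ 2 ∈ sosModule (P.constraint fLower fUpper) := by
  rcases i with i | i | i
  · refine ⟨1, zero_le_one, ?_⟩
    have := generator_mem_sosModule (P.constraint fLower fUpper) (.inr (.inr (.inl i)))
    simpa [constraint, inX] using this
  · refine ⟨1, zero_le_one, ?_⟩
    have := generator_mem_sosModule (P.constraint fLower fUpper) (.inr (.inl (.inr i)))
    simpa [constraint, inY] using this
  · exact ⟨_, sq_nonneg _,
      generator_mem_sosModule (P.constraint fLower fUpper) (.inr (.inr (.inr ())))⟩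

theorem exists_isFeasible_of_pos (hle : fLower ≤ fUpper) (hΩΔ : P.feasibleSet ⊆ cube n)
    {φ : MvPolynomial (Fin n) ℝ}
    (hφ : ∀ w ∈ P.projectedGraph fLower fUpper, w.2 < eval w.1 φ) :
    ∃ k s₀ s, P.IsFeasible fLower fUpper k φ s₀ s := by
  have hmem : inX φ - varZ n ∈ sosModule (P.constraint fLower fUpper) := by
    refine putinar _ P.bounded_variables fun w hw => ?_
    obtain ⟨x, y, z, rfl⟩ := exists_eq_xyzPoint w
    rw [P.forall_constraint_nonneg_iff hle hΩΔ] at hw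
    rw [map_sub, eval_xyzPoint_inX, eval_xyzPoint_varZ, sub_pos]
    exact hφ (x, z) ⟨hw.1, y, hw.2⟩
  obtain ⟨s₀, s, hs₀, hs, h⟩ := mem_sosModule.1 hmem
  refine ⟨φ.totalDegree + s₀.totalDegree +
    ∑ j, (s j * P.constraint fLower fUpper j).totalDegree, s₀, s, by lia, hs₀, hs, h, by lia,
    fun j => ?_⟩
  have := Finset.single_le_sum
    (f := fun j => (s j * P.constraint fLower fUpper j).totalDegree)
    (fun _ _ => Nat.zero_le _) (Finset.mem_univ j)
  lia

theorem exists_isFeasible_integral_lt (hle : fLower ≤ fUpper)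
    (hΩc : IsCompact P.feasibleSet) (hΩΔ : P.feasibleSet ⊆ cube n)
    (hK : ∀ x ∈ cube n, (P.fiber fLower fUpper x).Nonempty) {ε : ℝ} (hε : 0 < ε) :
    ∃ k φ s₀ s, P.IsFeasible fLower fUpper k φ s₀ s ∧
      ∫ x, eval x φ ∂(cubeMeasure n) < ∫ x, P.psiTilde fLower fUpper x ∂(cubeMeasure n) + ε := by
  obtain ⟨F, hF, hFge, hFint⟩ := exists_continuous_ge_upperEnvelope
    (P.isCompact_projectedGraph (fLower := fLower) (fUpper := fUpper) hΩc) (cubeMeasure n)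
    ((ae_mem_cube n).mono fun _ hx => P.exists_mem_projectedGraph hK hx) (half_pos hε)
  rw [← integral_congr_ae ((ae_mem_cube n).mono fun _ hx => P.psiTilde_eq_upperEnvelope hx)]
    at hFint
  -- Approximating `F + ε/4` within `ε/4` gives `F < φ < F + ε/2` on the cube; the other `ε/2` was
  -- spent on `F`.
  obtain ⟨φ, hφ⟩ := exists_mvPolynomial_near (isCompact_cube n)
    (F := fun x => F x + ε / 4) (by fun_prop) (show 0 < ε / 4 by linarith)
  obtain ⟨k, s₀, s, hfeas⟩ := P.exists_isFeasible_of_pos hle hΩΔ (φ := φ) fun w hw => by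
    have h1 := (abs_lt.1 (hφ w.1 hw.1)).1
    have h2 := hFge w hw
    linarith
  refine ⟨k, φ, s₀, s, hfeas, ?_⟩
  have : ∫ x, eval x φ ∂(cubeMeasure n) ≤ ∫ x, (F x + ε / 2) ∂(cubeMeasure n) := by
    refine integral_mono_ae (integrable_cubeMeasure_eval φ)
      (integrable_cubeMeasure_of_continuous (by fun_prop)) ((ae_mem_cube n).mono fun x hx => ?_)
    have h1 := (abs_lt.1 (hφ x hx)).2
    simp only
    linarith
  rw [integral_add (integrable_cubeMeasure_of_continuous hF) (integrable_const _),
    integral_const, measureReal_cubeMeasure_univ, one_smul] at this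
  linarith

theorem optimalValue_le {P : RationalVectorProblem n m r} {k : ℕ} {φ : MvPolynomial (Fin n) ℝ}
    {s₀ : MvPolynomial (XYZ n) ℝ} {s : ConstraintIndex n m r → MvPolynomial (XYZ n) ℝ}
    (h : P.IsFeasible fLower fUpper k φ s₀ s) :
    P.optimalValue fLower fUpper k ≤ ((∫ x, eval x φ ∂(cubeMeasure n) : ℝ) : EReal) :=
  sInf_le ⟨φ, s₀, s, h, rfl⟩

theorem integral_psiTilde_le_optimalValue (hle : fLower ≤ fUpper)
    (hΩc : IsCompact P.feasibleSet) (hΩΔ : P.feasibleSet ⊆ cube n)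
    (hK : ∀ x ∈ cube n, (P.fiber fLower fUpper x).Nonempty) (k : ℕ) :
    ((∫ x, P.psiTilde fLower fUpper x ∂(cubeMeasure n) : ℝ) : EReal) ≤
      P.optimalValue fLower fUpper k := by
  refine le_sInf ?_
  rintro _ ⟨φ, s₀, s, h, rfl⟩
  exact_mod_cast h.integral_psiTilde_le hle hΩc hΩΔ hK

theorem eventually_optimalValue_le (hle : fLower ≤ fUpper)
    (hΩc : IsCompact P.feasibleSet) (hΩΔ : P.feasibleSet ⊆ cube n)
    (hK : ∀ x ∈ cube n, (P.fiber fLower fUpper x).Nonempty) {ε : ℝ} (hε : 0 < ε) :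
    ∀ᶠ k in atTop, P.optimalValue fLower fUpper k ≤
      ((∫ x, P.psiTilde fLower fUpper x ∂(cubeMeasure n) + ε : ℝ) : EReal) := by
  obtain ⟨k₀, φ, s₀, s, h, hlt⟩ := P.exists_isFeasible_integral_lt hle hΩc hΩΔ hK hε
  filter_upwards [eventually_ge_atTop k₀] with k hk
  exact (optimalValue_le (h.mono hk)).trans (by exact_mod_cast hlt.le)

/-- The lower bound holds at every order, the upper bound only eventually: early values may be `+∞`.
-/
theorem tendsto_optimalValue (hle : fLower ≤ fUpper)
    (hΩc : IsCompact P.feasibleSet) (hΩΔ : P.feasibleSet ⊆ cube n)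
    (hK : ∀ x ∈ cube n, (P.fiber fLower fUpper x).Nonempty) :
    Tendsto (fun k => P.optimalValue fLower fUpper k) atTop
      (𝓝 ((∫ x, P.psiTilde fLower fUpper x ∂(cubeMeasure n) : ℝ) : EReal)) := by
  refine tendsto_order.2 ⟨fun a ha => .of_forall fun k => ha.trans_le
    (P.integral_psiTilde_le_optimalValue hle hΩc hΩΔ hK k), fun a ha => ?_⟩
  obtain ⟨c, hc1, hc2⟩ := EReal.lt_iff_exists_real_btwn.1 ha
  have hc : 0 < c - ∫ x, P.psiTilde fLower fUpper x ∂(cubeMeasure n) :=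
    sub_pos.2 (by exact_mod_cast hc1)
  filter_upwards [P.eventually_optimalValue_le hle hΩc hΩΔ hK hc] with k hk
  rw [add_sub_cancel] at hk
  exact hk.trans_lt hc2

theorem eventually_isOrder : ∀ᶠ k in atTop, P.IsOrder fLower fUpper k := by
  filter_upwards [eventually_ge_atTop (∑ j, (P.constraint fLower fUpper j).totalDegree)] with k hk j
  have := Finset.single_le_sum (f := fun j => (P.constraint fLower fUpper j).totalDegree)
    (fun _ _ => Nat.zero_le _) (Finset.mem_univ j)
  lia

theorem tendsto_integral_abs_sub (hle : fLower ≤ fUpper)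
    (hΩc : IsCompact P.feasibleSet) (hΩΔ : P.feasibleSet ⊆ cube n)
    (hK : ∀ x ∈ cube n, (P.fiber fLower fUpper x).Nonempty) {ε : ℕ → ℝ}
    {ψ : ℕ → MvPolynomial (Fin n) ℝ} {s₀ : ℕ → MvPolynomial (XYZ n) ℝ}
    {s : ℕ → ConstraintIndex n m r → MvPolynomial (XYZ n) ℝ} (hε : Tendsto ε atTop (𝓝 0))
    (h : ∀ k, P.IsOrder fLower fUpper k →
      P.IsFeasible fLower fUpper k (ψ k) (s₀ k) (s k) ∧
      ((∫ x, eval x (ψ k) ∂(cubeMeasure n) : ℝ) : EReal)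
        ≤ P.optimalValue fLower fUpper k + (ε k : EReal)) :
    Tendsto (fun k => ∫ x, |eval x (ψ k) - P.psiTilde fLower fUpper x| ∂(cubeMeasure n))
      atTop (𝓝 0) := by
  rw [Metric.tendsto_nhds]
  intro δ hδ
  filter_upwards [P.eventually_isOrder (fLower := fLower) (fUpper := fUpper),
    P.eventually_optimalValue_le hle hΩc hΩΔ hK (half_pos hδ),
    hε.eventually_lt_const (half_pos hδ)] with k hk hopt hεk
  obtain ⟨hfeas, hnear⟩ := h k hk
  have heq : ∫ x, |eval x (ψ k) - P.psiTilde fLower fUpper x| ∂(cubeMeasure n) =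
      ∫ x, eval x (ψ k) ∂(cubeMeasure n) - ∫ x, P.psiTilde fLower fUpper x ∂(cubeMeasure n) := by
    rw [← integral_sub (integrable_cubeMeasure_eval _) (P.integrable_psiTilde hΩc hK)]
    refine integral_congr_ae ((ae_mem_cube n).mono fun x hx => ?_)
    exact abs_of_nonneg (sub_nonneg.2 (hfeas.psiTilde_le hle hΩΔ hK hx))
  have hge := hfeas.integral_psiTilde_le hle hΩc hΩΔ hK
  have hlt : ∫ x, eval x (ψ k) ∂(cubeMeasure n) ≤
      ∫ x, P.psiTilde fLower fUpper x ∂(cubeMeasure n) + δ / 2 + ε k := by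
    have := hnear.trans (add_le_add_left hopt _)
    exact_mod_cast this
  rw [heq, Real.dist_eq, sub_zero, abs_of_nonneg (sub_nonneg.2 hge)]
  linarith

end RationalVectorProblem

/-! ### Degrees of sums of squares. -/

namespace MonomialOrder

variable {τ : Type*} {o : MonomialOrder τ}

/-- Nonnegative leading coefficients cannot cancel. -/
theorem degree_le_degree_add {f g : MvPolynomial τ ℝ} (hf : 0 ≤ o.leadingCoeff f)
    (hg : 0 ≤ o.leadingCoeff g) :
    o.toSyn (o.degree f) ≤ o.toSyn (o.degree (f + g)) ∧ 0 ≤ o.leadingCoeff (f + g) := by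
  rcases lt_trichotomy (o.toSyn (o.degree g)) (o.toSyn (o.degree f)) with h | h | h
  · rw [degree_add_of_lt h, leadingCoeff_add_of_lt h]
    exact ⟨le_rfl, hf⟩
  · rcases eq_or_ne f 0 with rfl | hf0
    · simpa using hg
    have hdeg : o.degree g = o.degree f := o.toSyn.injective h
    have hpos : 0 < o.leadingCoeff f := hf.lt_of_ne' (leadingCoeff_ne_zero_iff.2 hf0)
    have hco : coeff (o.degree f) (f + g) = o.leadingCoeff f + o.leadingCoeff g := by
      rw [coeff_add, leadingCoeff, leadingCoeff, hdeg]
    have hle : o.toSyn (o.degree f) ≤ o.toSyn (o.degree (f + g)) :=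
      o.le_degree (mem_support_iff.2 (by rw [hco]; positivity))
    refine ⟨hle, ?_⟩
    have heq : o.degree (f + g) = o.degree f := o.toSyn.injective
      (le_antisymm (degree_add_le.trans (by rw [hdeg, max_self])) hle)
    rw [leadingCoeff, heq, hco]
    positivity
  · rw [add_comm, degree_add_of_lt h, leadingCoeff_add_of_lt h]
    exact ⟨h.le, hg⟩

theorem leadingCoeff_nonneg_of_isSumSq {f : MvPolynomial τ ℝ} (hf : IsSumSq f) :
    0 ≤ o.leadingCoeff f := by
  induction hf with
  | zero => simp
  | sq_add a _ ih =>
    refine (degree_le_degree_add ?_ ih).2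
    rw [leadingCoeff_mul]
    exact mul_self_nonneg _

end MonomialOrder

/-- There is no cancellation of leading terms in a sum of two sums of squares. -/
theorem IsSumSq.totalDegree_le_add {τ : Type*} {f g : MvPolynomial τ ℝ} (hf : IsSumSq f)
    (hg : IsSumSq g) : f.totalDegree ≤ (f + g).totalDegree := by
  -- Any suitable order on the variables will do: the degree-lexicographic order compares total
  -- degrees first.
  obtain ⟨_, _⟩ := exists_wellFoundedGT τ
  exact degLex_totalDegree_monotone (MonomialOrder.degree_le_degree_add
    (MonomialOrder.leadingCoeff_nonneg_of_isSumSq hf)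
    (MonomialOrder.leadingCoeff_nonneg_of_isSumSq hg)).1

/-! ### Gram matrices of sums of squares. -/

section Gram

variable {ι A : Type*} [Fintype ι] [CommRing A] [Algebra ℝ A]

/-- The element `∑ Q_{bc} v_b v_c` with Gram matrix `Q` in the vectors `v`. -/
def gramMap (v : ι → A) : Matrix ι ι ℝ →ₗ[ℝ] A where
  toFun Q := ∑ b, ∑ c, Q b c • (v b * v c)
  map_add' Q R := by simp [add_smul, Finset.sum_add_distrib]
  map_smul' t Q := by simp [mul_smul, Finset.smul_sum]

theorem gramMap_apply (v : ι → A) (Q : Matrix ι ι ℝ) :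
    gramMap v Q = ∑ b, ∑ c, Q b c • (v b * v c) := rfl

theorem gramMap_vecMulVec (v : ι → A) (a : ι → ℝ) :
    gramMap v (Matrix.vecMulVec a (star a)) = (∑ b, a b • v b) * ∑ b, a b • v b := by
  rw [gramMap_apply, Finset.sum_mul_sum]
  simp only [Matrix.vecMulVec_apply, smul_mul_smul_comm, star_trivial]

/-- A positive semidefinite matrix is a sum of rank-one matrices `a aᵀ`, each giving one square. -/
theorem isSumSq_gramMap (v : ι → A) {Q : Matrix ι ι ℝ} (hQ : Q.PosSemidef) :
    IsSumSq (gramMap v Q) := by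
  obtain ⟨l, a, rfl⟩ := Matrix.posSemidef_iff_eq_sum_vecMulVec.1 hQ
  rw [map_sum]
  refine IsSumSq.sum fun i _ => ?_
  rw [gramMap_vecMulVec]
  exact .mul_self _

end Gram

section BoundedMonomials

variable {τ : Type*}

/-- The exponents of total degree at most `k`. -/
abbrev BoundedExponent (τ : Type*) (k : ℕ) : Type _ := {d : τ →₀ ℕ // d.degree ≤ k}

instance [Finite τ] (k : ℕ) : Finite (BoundedExponent τ k) :=
  (Finsupp.finite_of_degree_le (σ := τ) k).to_subtype

theorem eq_sum_monomial_of_totalDegree_le {k : ℕ} [Fintype (BoundedExponent τ k)]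
    {a : MvPolynomial τ ℝ} (ha : a.totalDegree ≤ k) :
    a = ∑ d : BoundedExponent τ k, coeff d.1 a • monomial d.1 1 := by
  classical
  ext e
  rw [coeff_sum]
  simp only [coeff_smul, coeff_monomial, smul_eq_mul, mul_ite, mul_one, mul_zero]
  by_cases he : e.degree ≤ k
  · rw [Finset.sum_eq_single (⟨e, he⟩ : BoundedExponent τ k)]
    · simp
    · rintro ⟨d, hd⟩ - hne
      rw [if_neg]
      rintro rfl
      exact hne rfl
    · simp
  · rw [Finset.sum_eq_zero]
    · by_contra h
      exact he ((le_totalDegree (mem_support_iff.2 h)).trans ha)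
    · rintro ⟨d, hd⟩ -
      rw [if_neg]
      rintro rfl
      exact he hd

/-- A sum of squares of degree at most `2k` has a positive semidefinite Gram matrix in the
monomials of degree at most `k`. -/
theorem exists_posSemidef_gramMap_eq {k : ℕ} [Fintype (BoundedExponent τ k)]
    {s : MvPolynomial τ ℝ} (hs : IsSumSq s) (hdeg : s.totalDegree ≤ 2 * k) :
    ∃ Q : Matrix (BoundedExponent τ k) (BoundedExponent τ k) ℝ, Q.PosSemidef ∧
      gramMap (fun d => monomial d.1 (1 : ℝ)) Q = s := by
  induction hs with
  | zero => exact ⟨0, .zero, map_zero _⟩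
  | @sq_add a s hs ih =>
    -- Without cancellation each summand inherits the degree bound, so `a` has degree at most `k`.
    have h1 := (IsSumSq.mul_self a).totalDegree_le_add hs
    have h2 := hs.totalDegree_le_add (.mul_self a)
    rw [add_comm] at h2
    obtain ⟨Q, hQ, rfl⟩ := ih (h2.trans hdeg)
    have ha : a.totalDegree ≤ k := by
      rcases eq_or_ne a 0 with rfl | ha0
      · simp
      rw [totalDegree_mul_of_isDomain ha0 ha0] at h1
      lia
    refine ⟨Matrix.vecMulVec (fun d => coeff d.1 a) (star fun d => coeff d.1 a) + Q,
      (Matrix.posSemidef_vecMulVec_self_star _).add hQ, ?_⟩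
    rw [map_add, gramMap_vecMulVec, ← eq_sum_monomial_of_totalDegree_le ha]

end BoundedMonomials

/-! ### Reduction to semidefinite programs in standard form. -/

namespace Matrix

theorem PosSemidef.blockDiagonal {ι κ : Type*} [Fintype ι] [Fintype κ] [DecidableEq κ]
    {Q : κ → Matrix ι ι ℝ} (hQ : ∀ j, (Q j).PosSemidef) : (Matrix.blockDiagonal Q).PosSemidef := by
  refine .of_dotProduct_mulVec_nonneg ?_ fun x => ?_
  · rw [IsHermitian, blockDiagonal_conjTranspose]
    congr 1
    ext1 j
    exact (hQ j).1
  · have : star x ⬝ᵥ (Matrix.blockDiagonal Q *ᵥ x) =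
        ∑ j, star (fun i => x (i, j)) ⬝ᵥ (Q j *ᵥ fun i => x (i, j)) := by
      simp only [dotProduct, mulVec, Fintype.sum_prod_type_right, blockDiagonal_apply]
      simp
    rw [this]
    exact Finset.sum_nonneg fun j _ => (hQ j).dotProduct_mulVec_nonneg _

/-- A linear functional on matrices is represented, on the symmetric matrices, by the trace
against a symmetric matrix. -/
theorem exists_isSymm_trace_mul_eq {ι : Type*} [Fintype ι] (l : Matrix ι ι ℝ →ₗ[ℝ] ℝ) :
    ∃ B : Matrix ι ι ℝ, B.IsSymm ∧ ∀ Y : Matrix ι ι ℝ, Y.IsSymm → (B * Y).trace = l Y := by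
  classical
  let B₀ : Matrix ι ι ℝ := of fun i j => l (single j i 1)
  have hB₀ : ∀ Y, (B₀ * Y).trace = l Y := fun Y => by
    conv_rhs => rw [matrix_eq_sum_single Y]
    simp only [trace, diag, mul_apply, map_sum, B₀, of_apply]
    rw [Finset.sum_comm]
    refine Finset.sum_congr rfl fun i _ => Finset.sum_congr rfl fun j _ => ?_
    rw [show single i j (Y i j) = Y i j • single i j (1 : ℝ) by simp, map_smul, smul_eq_mul,
      mul_comm]
  -- Symmetrizing does not change the trace against a symmetric `Y`.
  refine ⟨(1 / 2 : ℝ) • (B₀ + B₀ᵀ), ?_, fun Y hY => ?_⟩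
  · rw [IsSymm, transpose_smul, transpose_add, transpose_transpose, add_comm]
  · have : (B₀ᵀ * Y).trace = (B₀ * Y).trace := by
      rw [← trace_transpose, transpose_mul, transpose_transpose, hY.eq, trace_mul_comm]
    rw [smul_mul, trace_smul, add_mul, trace_add, this, hB₀, smul_eq_mul]
    ring

end Matrix

namespace SemidefiniteProgram

/-- `W` may be infinite-dimensional, but the range of `T` is not: coordinates in a basis of the
range turn `T Y = w` into finitely many trace equations. -/
theorem exists_feasible_eq {N : ℕ} {W : Type*} [AddCommGroup W] [Module ℝ W]
    (T : Matrix (Fin N) (Fin N) ℝ →ₗ[ℝ] W) (w : W) (c : Matrix (Fin N) (Fin N) ℝ →ₗ[ℝ] ℝ) :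
    ∃ (L : ℕ) (S : SemidefiniteProgram N L), S.feasible = {Y | Y.PosSemidef ∧ T Y = w} ∧
      ∀ Y ∈ S.feasible, (S.C * Y).trace = c Y := by
  obtain ⟨B, hB, hBc⟩ := Matrix.exists_isSymm_trace_mul_eq c
  have hsymm : ∀ {Y : Matrix (Fin N) (Fin N) ℝ}, Y.PosSemidef → Y.IsSymm := fun hY => by
    rw [Matrix.IsSymm, ← Matrix.conjTranspose_eq_transpose_of_trivial]
    exact hY.1
  by_cases hw : w ∈ LinearMap.range T
  · let b := Module.finBasis ℝ (LinearMap.range T)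
    choose D hD hDc using fun l => Matrix.exists_isSymm_trace_mul_eq
      ((b.coord l).comp T.rangeRestrict)
    refine ⟨_, ⟨B, D, fun l => b.coord l ⟨w, hw⟩, hB, hD⟩, ?_, fun Y hY => hBc Y (hsymm hY.1)⟩
    ext Y
    refine and_congr_right fun hY => ?_
    simp only [fun l => hDc l Y (hsymm hY), LinearMap.comp_apply, Module.Basis.coord_apply]
    rw [← DFunLike.ext_iff, b.repr.injective.eq_iff, Subtype.ext_iff]
    rfl
  -- If `w` is not attained, the equation `0 = 1` gives an empty feasible set.
  · refine ⟨1, ⟨B, fun _ => 0, fun _ => 1, hB, fun _ => Matrix.transpose_zero⟩, ?_,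
      fun Y hY => hBc Y (hsymm hY.1)⟩
    ext Y
    refine and_congr_right fun hY => ?_
    have : T Y ≠ w := fun h => hw ⟨Y, h⟩
    simp [this]

theorem exists_of_linear {ι W V : Type*} [Fintype ι] [AddCommGroup W] [Module ℝ W]
    [AddCommGroup V] [Module ℝ V] (T : Matrix ι ι ℝ →ₗ[ℝ] W) (w : W)
    (Φ : Matrix ι ι ℝ →ₗ[ℝ] V) (c : V →ₗ[ℝ] ℝ) :
    ∃ (N L : ℕ) (S : SemidefiniteProgram N L) (Φ' : Matrix (Fin N) (Fin N) ℝ →ₗ[ℝ] V),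
      (∀ v, (∃ Y : Matrix ι ι ℝ, Y.PosSemidef ∧ T Y = w ∧ Φ Y = v) ↔ ∃ Y ∈ S.feasible, Φ' Y = v) ∧
      ∀ Y ∈ S.feasible, (S.C * Y).trace = c (Φ' Y) := by
  let e := Fintype.equivFin ι
  let R : Matrix (Fin (Fintype.card ι)) (Fin (Fintype.card ι)) ℝ ≃ₗ[ℝ] Matrix ι ι ℝ :=
    Matrix.reindexLinearEquiv ℝ ℝ e.symm e.symm
  have hR : ∀ Y, (R Y).PosSemidef ↔ Y.PosSemidef := fun Y => Matrix.posSemidef_submatrix_equiv e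
  obtain ⟨L, S, hS, hSc⟩ := exists_feasible_eq (T ∘ₗ R.toLinearMap) w (c ∘ₗ Φ ∘ₗ R.toLinearMap)
  refine ⟨_, L, S, Φ ∘ₗ R.toLinearMap, fun v => ?_, hSc⟩
  rw [hS]
  constructor
  · rintro ⟨Y, hY, hT, hv⟩
    refine ⟨R.symm Y, ⟨(hR _).1 (by simpa using hY), by simpa using hT⟩, by simpa using hv⟩
  · rintro ⟨Y, ⟨hY, hT⟩, hv⟩
    exact ⟨R Y, (hR Y).2 hY, hT, hv⟩

end SemidefiniteProgram

/-- Integration of polynomials over the cube. -/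
noncomputable def cubeIntegral (n : ℕ) : MvPolynomial (Fin n) ℝ →ₗ[ℝ] ℝ where
  toFun φ := ∫ x, eval x φ ∂(cubeMeasure n)
  map_add' φ χ := by
    simp only [map_add]
    exact integral_add (integrable_cubeMeasure_eval φ) (integrable_cubeMeasure_eval χ)
  map_smul' t φ := by
    simp only [smul_eval, RingHom.id_apply, smul_eq_mul]
    exact integral_const_mul t _

/-- The substitution `y = 0`, `z = 0`, from `ℝ[x, y, z]` to `ℝ[x]`. -/
noncomputable def restrictX (n : ℕ) : MvPolynomial (XYZ n) ℝ →ₐ[ℝ] MvPolynomial (Fin n) ℝ :=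
  aeval (Sum.elim X fun _ => 0)

theorem restrictX_inX_sub_varZ {n : ℕ} (φ : MvPolynomial (Fin n) ℝ) :
    restrictX n (inX φ - varZ n) = φ := by
  rw [map_sub, restrictX, inX, varZ, aeval_rename, aeval_X]
  simp [Sum.elim_comp_inl]

namespace RationalVectorProblem

variable {n m r : ℕ} (P : RationalVectorProblem n m r) (fLower fUpper : ℝ)

/-- One matrix carries the Gram matrices of all multipliers as diagonal blocks, with `none` indexing
`σ₀` and its factor `1`. Off-diagonal blocks may be arbitrary, since principal submatrices of a
positive semidefinite matrix are positive semidefinite. The polynomial `φ` is recovered from the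
certificate by setting `y = z = 0`. -/
theorem exists_semidefiniteProgram (k : ℕ) :
    ∃ (N L : ℕ) (S : SemidefiniteProgram N L)
      (Φ : Matrix (Fin N) (Fin N) ℝ →ₗ[ℝ] MvPolynomial (Fin n) ℝ),
      (∀ φ, (∃ s₀ s, P.IsFeasible fLower fUpper k φ s₀ s) ↔ ∃ Y ∈ S.feasible, Φ Y = φ) ∧
      ∀ Y ∈ S.feasible, (S.C * Y).trace = ∫ x, eval x (Φ Y) ∂(cubeMeasure n) := by
  classical
  have := Fintype.ofFinite (BoundedExponent (XYZ n) k)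
  let J := Option (ConstraintIndex n m r)
  let h : J → MvPolynomial (XYZ n) ℝ := fun j => j.elim 1 (P.constraint fLower fUpper)
  let B := BoundedExponent (XYZ n) k
  let block (j : J) : Matrix (B × J) (B × J) ℝ →ₗ[ℝ] Matrix B B ℝ :=
    { toFun := fun Y => Y.blockDiag j
      map_add' := fun _ _ => rfl
      map_smul' := fun _ _ => rfl }
  let sos (j : J) : Matrix (B × J) (B × J) ℝ →ₗ[ℝ] MvPolynomial (XYZ n) ℝ :=
    gramMap (fun d : B => monomial d.1 (1 : ℝ)) ∘ₗ block j
  let term (j : J) : Matrix (B × J) (B × J) ℝ →ₗ[ℝ] MvPolynomial (XYZ n) ℝ :=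
    LinearMap.mulRight ℝ (h j) ∘ₗ sos j
  let G : Matrix (B × J) (B × J) ℝ →ₗ[ℝ] MvPolynomial (XYZ n) ℝ := ∑ j, term j
  let Φ : Matrix (B × J) (B × J) ℝ →ₗ[ℝ] MvPolynomial (Fin n) ℝ := (restrictX n).toLinearMap ∘ₗ G
  let incl : MvPolynomial (Fin n) ℝ →ₗ[ℝ] MvPolynomial (XYZ n) ℝ := (rename Sum.inl).toLinearMap
  -- Equal to `(z, 0, 0)` exactly when the certificate equals `φ(x) - z` and all degree bounds hold,
  -- the latter expressed as vanishing modulo polynomials of degree at most `2k`.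
  let T := (incl ∘ₗ Φ - G).prod
    (((restrictTotalDegree (Fin n) ℝ (2 * k)).mkQ ∘ₗ Φ).prod
      (LinearMap.pi fun j => (restrictTotalDegree (XYZ n) ℝ (2 * k)).mkQ ∘ₗ term j))
  obtain ⟨N, L, S, Φ', hΦ', hS⟩ := SemidefiniteProgram.exists_of_linear T (varZ n, 0, 0) Φ
    (cubeIntegral n)
  refine ⟨N, L, S, Φ', fun φ => ?_, hS⟩
  rw [← hΦ']
  have hG : ∀ Y, G Y = sos none Y + ∑ j, sos (some j) Y * P.constraint fLower fUpper j := fun Y => by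
    simp [G, term, h, J, Fintype.sum_option]
  have hT : ∀ Y, T Y = (varZ n, 0, 0) ↔ inX (Φ Y) - G Y = varZ n ∧ (Φ Y).totalDegree ≤ 2 * k ∧
      ∀ j, (sos j Y * h j).totalDegree ≤ 2 * k := fun Y => by
    simp only [T, LinearMap.prod_apply, Function.prod_apply, Prod.mk.injEq]
    refine and_congr Iff.rfl (and_congr ?_ ?_)
    · rw [LinearMap.comp_apply, Submodule.mkQ_apply, Submodule.Quotient.mk_eq_zero,
        mem_restrictTotalDegree]
    · rw [funext_iff]
      refine forall_congr' fun j => ?_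
      rw [LinearMap.pi_apply, LinearMap.comp_apply, Submodule.mkQ_apply, Pi.zero_apply,
        Submodule.Quotient.mk_eq_zero, mem_restrictTotalDegree]
      rfl
  constructor
  · rintro ⟨s₀, s, h1, h2, h3, h4, h5, h6⟩
    let s' : J → MvPolynomial (XYZ n) ℝ := fun j => j.elim s₀ s
    have hQ : ∀ j, ∃ Q : Matrix B B ℝ, Q.PosSemidef ∧
        gramMap (fun d : B => monomial d.1 (1 : ℝ)) Q * h j = s' j * h j := by
      rintro (_ | j)
      · obtain ⟨Q, hQ, hQs⟩ := exists_posSemidef_gramMap_eq h2 h5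
        exact ⟨Q, hQ, by rw [hQs]; rfl⟩
      -- For a zero constraint the bound on the product does not control the degree of the
      -- multiplier, which is replaced by `0`.
      · by_cases hz : P.constraint fLower fUpper j = 0
        · exact ⟨0, .zero, by simp [h, hz]⟩
        · have hd : (s j).totalDegree ≤ 2 * k := by
            rcases eq_or_ne (s j) 0 with hs0 | hs0
            · simp [hs0]
            have := h6 j
            rw [totalDegree_mul_of_isDomain hs0 hz] at this
            lia
          obtain ⟨Q, hQ, hQs⟩ := exists_posSemidef_gramMap_eq (h3 j) hd
          exact ⟨Q, hQ, by rw [hQs]; rfl⟩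
    choose Q hQ hQs using hQ
    have hterm : ∀ j, sos j (Matrix.blockDiagonal Q) * h j = s' j * h j := fun j => by
      rw [← hQs j]
      change gramMap _ ((Matrix.blockDiagonal Q).blockDiag j) * h j = _
      rw [Matrix.blockDiag_blockDiagonal]
    have hGφ : G (Matrix.blockDiagonal Q) = inX φ - varZ n := by
      rw [h4]
      change (∑ j, term j) _ = _
      rw [LinearMap.sum_apply]
      refine (Finset.sum_congr rfl fun j _ => hterm j).trans ?_
      rw [Fintype.sum_option]
      simp [s', h]
    have hΦφ : Φ (Matrix.blockDiagonal Q) = φ := by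
      change restrictX n (G _) = φ
      rw [hGφ, restrictX_inX_sub_varZ]
    refine ⟨_, .blockDiagonal hQ, (hT _).2 ⟨by rw [hΦφ, hGφ]; ring, by rwa [hΦφ], fun j => ?_⟩, hΦφ⟩
    rw [hterm]
    rcases j with _ | j
    · simpa [s', h] using h5
    · exact h6 j
  · rintro ⟨Y, hY, hTY, rfl⟩
    obtain ⟨h1, h2, h3⟩ := (hT Y).1 hTY
    have hsos : ∀ j, IsSumSq (sos j Y) := fun j =>
      isSumSq_gramMap _ (hY.submatrix fun b => (b, j))
    refine ⟨sos none Y, fun j => sos (some j) Y, h2, hsos _, fun j => hsos _, ?_, ?_,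
      fun j => h3 (some j)⟩
    · rw [← hG, ← h1]
      ring
    · simpa [h] using h3 none

end RationalVectorProblem

theorem theorem4p5 {n m r : ℕ} (hm : 0 < m) (P : RationalVectorProblem n m r)
    (hΩ : P.feasibleSet.Nonempty) (hΩc : IsCompact P.feasibleSet)
    (hΩΔ : P.feasibleSet ⊆ cube n)
    (hq : ∀ i, ∀ x ∈ P.feasibleSet, 0 < eval x (P.q i))
    (lower upper : Fin m → ℝ)
    (hlower : ∀ i, P.IsCertified (P.p i - C (lower i) * P.q i))
    (hupper : ∀ i, P.IsCertified (C (upper i) * P.q i - P.p i))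
    (fLower fUpper : ℝ) (hfLower : fLower = ⨅ i, lower i) (hfUpper : fUpper = ⨆ i, upper i)
    -- `ψ̃` is a well defined real function on `Δ`: its maximum is over a nonempty set
    (hK : ∀ x ∈ cube n, (P.fiber fLower fUpper x).Nonempty) :
    -- the optimal values converge to the integral of `ψ̃`
    Integrable (P.psiTilde fLower fUpper) (cubeMeasure n) ∧
    Tendsto (fun k => P.optimalValue fLower fUpper k) atTop
      (𝓝 ((∫ x, P.psiTilde fLower fUpper x ∂(cubeMeasure n) : ℝ) : EReal)) ∧
    -- nearly optimal solutions, with any tolerances `ε k → 0`, for instance `ε k = 1 / k`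
    (∀ (ε : ℕ → ℝ) (ψ : ℕ → MvPolynomial (Fin n) ℝ) (σ₀ : ℕ → MvPolynomial (XYZ n) ℝ)
      (σ : ℕ → ConstraintIndex n m r → MvPolynomial (XYZ n) ℝ),
      Tendsto ε atTop (𝓝 0) →
      (∀ k, P.IsOrder fLower fUpper k →
        P.IsFeasible fLower fUpper k (ψ k) (σ₀ k) (σ k) ∧
        ((∫ x, eval x (ψ k) ∂(cubeMeasure n) : ℝ) : EReal)
          ≤ P.optimalValue fLower fUpper k + (ε k : EReal)) →
      (∀ k, P.IsOrder fLower fUpper k →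
        ∀ x ∈ cube n, P.psiTilde fLower fUpper x ≤ eval x (ψ k)) ∧
      Tendsto (fun k => ∫ x, |eval x (ψ k) - P.psiTilde fLower fUpper x| ∂(cubeMeasure n))
        atTop (𝓝 0)) ∧
    -- every problem `(P_k)` is a semidefinite program: `φ` is read off linearly from the matrix
    (∀ k, P.IsOrder fLower fUpper k →
      ∃ (N L : ℕ) (S : SemidefiniteProgram N L)
        (Φ : Matrix (Fin N) (Fin N) ℝ →ₗ[ℝ] MvPolynomial (Fin n) ℝ),
        (∀ φ, (∃ σ₀ σ, P.IsFeasible fLower fUpper k φ σ₀ σ) ↔ ∃ Y ∈ S.feasible, Φ Y = φ) ∧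
        ∀ Y ∈ S.feasible,
          (S.C * Y).trace = ∫ x, eval x (Φ Y) ∂(cubeMeasure n)) := by
  have hle : fLower ≤ fUpper := by
    rw [hfLower, hfUpper]
    exact P.iInf_le_iSup_of_isCertified hm hΩ hΩΔ hq lower upper hlower hupper
  exact ⟨P.integrable_psiTilde hΩc hK, P.tendsto_optimalValue hle hΩc hΩΔ hK,
    fun _ _ _ _ hε h => ⟨fun k hk _ hx => (h k hk).1.psiTilde_le hle hΩΔ hK hx,
      P.tendsto_integral_abs_sub hle hΩc hΩΔ hK hε h⟩,
    fun k _ => P.exists_semidefiniteProgram fLower fUpper k⟩
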